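/- Let $E$ and $F$ be real Banach lattices such that $F$ is $\sigma$-Dedekind complete (every nonempty countable subset of $F$ that is bounded above has a supremum). Then the following statements are equivalent: 1. Every order bounded weak almost limited operator $T:E\to F$ is almost Dunford–Pettis. 2. Every positive weak almost limited operator $T:E\to F$ is almost Dunford–Pettis. 3. At least one of the following holds: (i) $E$ has the positive Schur property; (ii) the norm of $F$ is order continuous. Here an operator is a bounded linear map. A norm bounded set $A\subseteq F$ is *almost limited* if $\sup_{y\in A}|f_n(y)|\to 0$ for every weak* null sequence $(f_n)$ in $F^*$ with $|f_n|\wedge|f_m|=0$ for $n\ne m$. An operator $T:E\to F$ is *weak almost limited* if it maps relatively weakly compact sets of $E$ to almost limited sets of $F$; it is *almost Dunford–Pettis* if $\|Tx_n\|\to 0$ for every weakly null sequence $(x_n)$ in $E$ with $|x_n|\wedge|x_m|=0$ for $n\neq m$; it is *order bounded* if it maps order intervals into order intervals. $E$ has the *positive Schur property* if $\|x_n\|\to0$ for every weakly null sequence $(x_n)$ of positive elements of $E$. The norm of $F$ is *order continuous* if $\|x_\alpha\|\to0$ for every net $x_\alpha\downarrow 0$ in $F$. -/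

import Mathlib

namespace BanachLat

open Filter Topology

section Dual

variable {E : Type*} [NormedAddCommGroup E] [NormedSpace ℝ E] [Lattice E] [IsOrderedAddMonoid E]

/-- The canonical order of the dual `E*` of a Banach lattice `E`:
`f ≤ g` if and only if `f x ≤ g x` for every `x ≥ 0`. -/
instance dualPartialOrder : PartialOrder (StrongDual ℝ E) where
  le f g := ∀ x : E, 0 ≤ x → f x ≤ g x
  le_refl _ _ _ := le_rfl
  le_trans _ _ _ hfg hgh x hx := (hfg x hx).trans (hgh x hx)
  le_antisymm f g hfg hgf := by
    have h : ∀ x : E, 0 ≤ x → f x = g x := fun x hx => le_antisymm (hfg x hx) (hgf x hx)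
    ext x
    rw [← posPart_sub_negPart x, map_sub, map_sub, h _ (posPart_nonneg x),
      h _ (negPart_nonneg x)]

/-- `f` and `g` are disjoint in `E*`, that is, `|f| ⊓ |g| = 0`, where `|f| = f ⊔ (-f)` and the
suprema and infima are those of the order of `E*`. -/
def DualDisjoint (f g : StrongDual ℝ E) : Prop :=
  ∃ a b : StrongDual ℝ E, IsLUB {f, -f} a ∧ IsLUB {g, -g} b ∧ IsGLB {a, b} 0

/-- A sequence of pairwise disjoint elements of `E*`. -/
def DualDisjointSeq (f : ℕ → StrongDual ℝ E) : Prop :=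
  Pairwise fun m n => DualDisjoint (f m) (f n)

end Dual

/-- The sequence `(x n)` is weakly null. -/
def WeaklyNull {X : Type*} [NormedAddCommGroup X] [NormedSpace ℝ X] (x : ℕ → X) : Prop :=
  ∀ f : StrongDual ℝ X, Tendsto (fun n => f (x n)) atTop (𝓝 0)

/-- The sequence `(f n)` in the dual is weak* null. -/
def WeakStarNull {X : Type*} [NormedAddCommGroup X] [NormedSpace ℝ X]
    (f : ℕ → StrongDual ℝ X) : Prop :=
  ∀ x : X, Tendsto (fun n => f n x) atTop (𝓝 0)

/-- `W` is relatively weakly compact: its closure in the weak topology is weakly compact. -/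
def RelWeaklyCompact {X : Type*} [NormedAddCommGroup X] [NormedSpace ℝ X] (W : Set X) : Prop :=
  IsCompact (closure (toWeakSpace ℝ X '' W))

/-- A sequence of pairwise disjoint elements of a vector lattice. -/
def DisjointSeq {E : Type*} [Lattice E] [AddGroup E] (x : ℕ → E) : Prop :=
  Pairwise fun m n => |x m| ⊓ |x n| = 0

/-- Every nonempty countable set which is bounded above has a supremum. -/
def SigmaDedekindComplete (E : Type*) [Lattice E] : Prop :=
  ∀ s : Set E, s.Countable → s.Nonempty → BddAbove s → ∃ a, IsLUB s a

/-- The norm is order continuous: `x_α ↓ 0` implies `‖x_α‖ → 0`. A decreasing net is given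
by the set of its values, a nonempty downward directed set. -/
def OrderContinuousNorm (E : Type*) [NormedAddCommGroup E] [Lattice E] : Prop :=
  ∀ s : Set E, s.Nonempty → DirectedOn (fun x y => y ≤ x) s → IsGLB s 0 →
    ∀ ε : ℝ, 0 < ε → ∃ x ∈ s, ∀ y ∈ s, y ≤ x → ‖y‖ < ε

/-- Every weakly null sequence of positive elements is norm null. -/
def PositiveSchur (E : Type*) [NormedAddCommGroup E] [NormedSpace ℝ E] [Lattice E] : Prop :=
  ∀ x : ℕ → E, (∀ n, 0 ≤ x n) → WeaklyNull x → Tendsto (fun n => ‖x n‖) atTop (𝓝 0)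

/-- An almost limited set: a norm bounded set on which every disjoint weak* null sequence of the
dual converges uniformly to zero. -/
def AlmostLimitedSet {E : Type*} [NormedAddCommGroup E] [NormedSpace ℝ E] [Lattice E]
    [IsOrderedAddMonoid E] (A : Set E) : Prop :=
  Bornology.IsBounded A ∧
    ∀ f : ℕ → StrongDual ℝ E, DualDisjointSeq f → WeakStarNull f →
      TendstoUniformlyOn (fun n x => f n x) (fun _ => 0) atTop A

/-- A weak almost limited operator carries relatively weakly compact sets to almost limited
sets. -/
def WeakAlmostLimited {X E : Type*} [NormedAddCommGroup X] [NormedSpace ℝ X]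
    [NormedAddCommGroup E] [NormedSpace ℝ E] [Lattice E] [IsOrderedAddMonoid E]
    (T : X →L[ℝ] E) : Prop :=
  ∀ W : Set X, RelWeaklyCompact W → AlmostLimitedSet (T '' W)

/-- An almost Dunford-Pettis operator carries disjoint weakly null sequences to norm null
sequences. -/
def AlmostDunfordPettis {E X : Type*} [NormedAddCommGroup E] [NormedSpace ℝ E] [Lattice E]
    [NormedAddCommGroup X] [NormedSpace ℝ X] (T : E →L[ℝ] X) : Prop :=
  ∀ x : ℕ → E, DisjointSeq x → WeaklyNull x → Tendsto (fun n => ‖T (x n)‖) atTop (𝓝 0)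

/-- An order bounded operator carries order intervals into order intervals. -/
def OrderBoundedOp {E F : Type*} [NormedAddCommGroup E] [NormedSpace ℝ E] [Lattice E]
    [NormedAddCommGroup F] [NormedSpace ℝ F] [Lattice F] (T : E →L[ℝ] F) : Prop :=
  ∀ a b : E, ∃ c d : F, T '' Set.Icc a b ⊆ Set.Icc c d

/-- A positive operator. -/
def PositiveOp {E F : Type*} [NormedAddCommGroup E] [NormedSpace ℝ E] [Lattice E]
    [NormedAddCommGroup F] [NormedSpace ℝ F] [Lattice F] (T : E →L[ℝ] F) : Prop :=
  ∀ x : E, 0 ≤ x → 0 ≤ T x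

end BanachLat

/-!
# Weak almost limited operators and almost Dunford–Pettis operators

A positive operator maps order intervals into order intervals, so the statement about order bounded
operators contains the one about positive operators.

Suppose first that `E` has the positive Schur property or that the norm of `F` is order continuous,
and let `(x n)` be disjoint and weakly null. By the Hahn–Banach theorem the moduli of `T (x n)` are
weakly null for every order bounded `T` (`OrderBoundedOp.weaklyNull_abs`). With `T = id` this
settles the case of the positive Schur property. If the norm of `F` is order continuous and
`‖T (x n)‖` does not tend to zero, functionals norming the positive parts of `± T (x n)` can be made
disjoint (`exists_disjoint_functionals`); they are then weak* null (`weakStarNull_of_disjoint`),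
although they do not tend to zero uniformly on the image of the weakly compact set `{x n} ∪ {0}`.

Conversely, suppose that `E` fails the positive Schur property and that the norm of `F` is not order
continuous. Then `E` contains a disjoint weakly null sequence of positive elements `z n` with norms
bounded below (`exists_disjoint_weaklyNull`), and an order interval `[0, u]` of `F` contains all
partial sums of a series of positive elements `v n` with norms bounded below
(`exists_order_bounded_series`). If `f n` is a positive functional norming `z n`, the operator
`T x = ∑ f n (x) v n`, an order convergent sum, maps the unit ball into `[-u, u]`, and `‖T (z n)‖`
is bounded below. It is weak almost limited because order intervals of a `σ`-Dedekind complete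
Banach lattice are almost limited sets (`tendsto_abs_dual_apply`).

Three of these steps rest on `exists_disjoint_carriers`: disjoint positive functionals that are
bounded at `u` are, along a subsequence, almost carried by disjoint elements of `[0, u]`. To get
it, split `u` into `N` parts almost carrying `N` of the functionals. Each of the remaining ones is
small on one of the parts, hence infinitely many are small on the same part. That part is set
aside, and the procedure continues with its complement.
-/

namespace BanachLat

open Filter Topology

/-! ### Disjointness in vector lattices -/

section LatticeGroup

variable {G : Type*} [AddCommGroup G] [Lattice G] [IsOrderedAddMonoid G]

theorem inf_add_le_inf_add_inf {a b c : G} (ha : 0 ≤ a) (hb : 0 ≤ b) (hc : 0 ≤ c) :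
    a ⊓ (b + c) ≤ a ⊓ b + a ⊓ c := by
  rw [add_inf, inf_add, inf_add]
  refine le_inf (le_inf ?_ ?_) (le_inf ?_ inf_le_right)
  · exact inf_le_left.trans (le_add_of_nonneg_left ha)
  · exact inf_le_left.trans (le_add_of_nonneg_left hb)
  · exact inf_le_left.trans (le_add_of_nonneg_right hc)

theorem inf_eq_zero_of_le {L : Type*} [Lattice L] [Zero L] {a b c d : L} (ha : 0 ≤ a)
    (hb : 0 ≤ b) (hac : a ≤ c) (hbd : b ≤ d) (h : c ⊓ d = 0) : a ⊓ b = 0 :=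
  le_antisymm ((inf_le_inf hac hbd).trans h.le) (le_inf ha hb)

theorem inf_sum_eq_zero {ι : Type*} {a : G} (ha : 0 ≤ a) {b : ι → G} (s : Finset ι)
    (hb : ∀ i ∈ s, 0 ≤ b i) (h : ∀ i ∈ s, a ⊓ b i = 0) : a ⊓ ∑ i ∈ s, b i = 0 := by
  classical
  induction s using Finset.induction_on with
  | empty => simpa using ha
  | insert i s hi ih =>
    rw [Finset.sum_insert hi]
    have hs : 0 ≤ ∑ i ∈ s, b i :=
      Finset.sum_nonneg fun j hj => hb j (Finset.mem_insert_of_mem hj)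
    have hbi := hb i (Finset.mem_insert_self i s)
    refine le_antisymm ((inf_add_le_inf_add_inf ha hbi hs).trans ?_) (le_inf ha (add_nonneg hbi hs))
    rw [h i (Finset.mem_insert_self i s),
      ih (fun j hj => hb j (Finset.mem_insert_of_mem hj))
        (fun j hj => h j (Finset.mem_insert_of_mem hj)), add_zero]

theorem add_le_of_inf_eq_zero {a b c : G} (h : a ⊓ b = 0) (hac : a ≤ c) (hbc : b ≤ c) :
    a + b ≤ c := by
  rw [← inf_add_sup, h, zero_add]
  exact sup_le hac hbc

theorem abs_add_of_disjoint {a b : G} (h : |a| ⊓ |b| = 0) : |a + b| = |a| + |b| := by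
  refine le_antisymm (abs_add_le a b) ?_
  have h1 := sup_sub_inf_eq_abs_sub |a| |b|
  rw [h, sub_zero] at h1
  have h2 : |a| + |b| = |a| ⊔ |b| := by rw [← inf_add_sup, h, zero_add]
  rw [h2, h1]
  simpa [abs_sub_comm, sub_eq_add_neg, add_comm] using abs_abs_sub_abs_le b (-a)

/-- The modulus is additive on disjoint elements. In particular it does not see signs there. -/
theorem abs_sum_of_disjoint {ι : Type*} (x : ι → G) (s : Finset ι)
    (h : ∀ i ∈ s, ∀ j ∈ s, i ≠ j → |x i| ⊓ |x j| = 0) :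
    |∑ i ∈ s, x i| = ∑ i ∈ s, |x i| := by
  classical
  induction s using Finset.induction_on with
  | empty => simp
  | insert i s hi ih =>
    have ih' := ih fun j hj k hk =>
      h j (Finset.mem_insert_of_mem hj) k (Finset.mem_insert_of_mem hk)
    rw [Finset.sum_insert hi, Finset.sum_insert hi, abs_add_of_disjoint, ih']
    rw [ih']
    exact inf_sum_eq_zero (abs_nonneg _) s (fun j _ => abs_nonneg _) fun j hj =>
      h i (Finset.mem_insert_self i s) j (Finset.mem_insert_of_mem hj)
        (fun e => hi (e ▸ hj))

theorem sum_le_of_disjoint {x : ℕ → G} {u : G} (hx : ∀ n, 0 ≤ x n) (hxu : ∀ n, x n ≤ u)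
    (h : Pairwise fun m n => x m ⊓ x n = 0) (s : Finset ℕ) : ∑ i ∈ s, x i ≤ u := by
  classical
  induction s using Finset.induction_on with
  | empty => simpa using (hx 0).trans (hxu 0)
  | insert i s hi ih =>
    rw [Finset.sum_insert hi]
    refine add_le_of_inf_eq_zero ?_ (hxu i) ih
    exact inf_sum_eq_zero (hx i) s (fun j _ => hx j) fun j hj => h fun e => hi (e ▸ hj)

/-- A bound for all sums with signs is a bound for the sum of the moduli. -/
theorem sum_abs_le_of_forall_signs {ι : Type*} (y : ι → G) (s : Finset ι) {w : G}
    (h : ∀ σ : ι → ℤ, (∀ i, σ i = 1 ∨ σ i = -1) → ∑ i ∈ s, σ i • y i ≤ w) :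
    ∑ i ∈ s, |y i| ≤ w := by
  classical
  induction s using Finset.induction_on generalizing w with
  | empty => simpa using h (fun _ => 1) (fun _ => Or.inl rfl)
  | insert i s hi ih =>
    rw [Finset.sum_insert hi, ← le_sub_iff_add_le]
    have key : ∀ c : ℤ, (c = 1 ∨ c = -1) → ∑ j ∈ s, |y j| ≤ w - c • y i := by
      intro c hc
      refine ih fun σ hσ => ?_
      have := h (Function.update σ i c) fun j => by
        by_cases hj : j = i
        · subst hj; simpa using hc
        · simpa [hj] using hσ j
      rw [Finset.sum_insert hi, Function.update_self] at this
      rw [le_sub_iff_add_le, add_comm]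
      refine le_trans (le_of_eq ?_) this
      congr 1
      refine Finset.sum_congr rfl fun j hj => ?_
      rw [Function.update_of_ne (show j ≠ i from fun e => hi (e ▸ hj))]
    refine abs_le'.2 ⟨?_, ?_⟩
    · have := key 1 (Or.inl rfl)
      rw [one_smul] at this
      exact le_sub_comm.1 this
    · have := key (-1) (Or.inr rfl)
      rw [neg_one_zsmul] at this
      exact le_sub_comm.1 this

end LatticeGroup

section VectorLattice

variable {G : Type*} [AddCommGroup G] [Module ℝ G] [Lattice G] [IsOrderedAddMonoid G]
  [IsOrderedModule ℝ G]

theorem abs_real_smul (c : ℝ) (x : G) : |c • x| = |c| • |x| := by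
  have pos : ∀ c : ℝ, 0 ≤ c → |c • x| = c • |x| := by
    intro c hc
    rcases hc.eq_or_lt with rfl | hc
    · simp
    refine le_antisymm (abs_le'.2 ⟨smul_le_smul_of_nonneg_left (le_abs_self x) hc.le, ?_⟩) ?_
    · rw [← smul_neg]
      exact smul_le_smul_of_nonneg_left (neg_le_abs x) hc.le
    · rw [← le_inv_smul_iff_of_pos hc]
      refine abs_le'.2 ⟨?_, ?_⟩
      · rw [le_inv_smul_iff_of_pos hc]; exact le_abs_self _
      · rw [le_inv_smul_iff_of_pos hc, smul_neg]; exact neg_le_abs _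
  rcases le_total 0 c with hc | hc
  · rw [pos c hc, abs_of_nonneg hc]
  · rw [← abs_neg, ← neg_smul, pos (-c) (by linarith), abs_of_nonpos hc]

theorem inf_smul_eq_zero {a b : G} (ha : 0 ≤ a) (hb : 0 ≤ b) (h : a ⊓ b = 0) {c : ℝ} (hc : 0 ≤ c) :
    a ⊓ c • b = 0 := by
  have hc1 : 1 ≤ c + 1 := by linarith
  have hc0 : 0 < c + 1 := by linarith
  refine inf_eq_zero_of_le ha (smul_nonneg hc hb) (c := (c + 1) • a) (d := (c + 1) • b) ?_ ?_ ?_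
  · simpa using smul_le_smul_of_nonneg_right hc1 ha
  · exact smul_le_smul_of_nonneg_right (by linarith) hb
  · refine le_antisymm ?_ (le_inf (smul_nonneg hc0.le ha) (smul_nonneg hc0.le hb))
    rw [← smul_zero (c + 1), ← inv_smul_le_iff_of_pos hc0, ← h]
    exact le_inf ((inv_smul_le_iff_of_pos hc0).2 inf_le_left)
      ((inv_smul_le_iff_of_pos hc0).2 inf_le_right)

theorem posPart_inf_posPart_smul_sub (a b : G) {s : ℝ} (hs : 1 ≤ s) :
    (a - s⁻¹ • b)⁺ ⊓ (b - s • a)⁺ = 0 := by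
  have hs0 : 0 < s := by linarith
  refine inf_eq_zero_of_le (posPart_nonneg _) (posPart_nonneg _) (c := (b - s • a)⁻) ?_ le_rfl
    (by rw [inf_comm, posPart_inf_negPart_eq_zero])
  have h1 : a - s⁻¹ • b = s⁻¹ • (-(b - s • a)) := by
    rw [neg_sub, smul_sub, smul_smul, inv_mul_cancel₀ hs0.ne', one_smul]
  rw [posPart_def, h1]
  refine sup_le ?_ (negPart_nonneg _)
  calc s⁻¹ • (-(b - s • a)) ≤ s⁻¹ • (b - s • a)⁻ :=
        smul_le_smul_of_nonneg_left (neg_le_negPart _) (by positivity)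
    _ ≤ (1 : ℝ) • (b - s • a)⁻ :=
        smul_le_smul_of_nonneg_right (inv_le_one_of_one_le₀ hs) (negPart_nonneg _)
    _ = _ := one_smul _ _

/-- Subtracting a large multiple of the preceding terms and a small multiple of a common bound
of all terms turns a sequence of positive elements into a disjoint one. -/
theorem pairwise_disjoint_posPart_sub {x : ℕ → G} {X : G} (hx : ∀ i, 0 ≤ x i)
    (hX : ∀ i, (2⁻¹ : ℝ) ^ i • x i ≤ X) :
    Pairwise fun m n =>
      (x m - (4 : ℝ) ^ m • ∑ i ∈ Finset.range m, x i - (2⁻¹ : ℝ) ^ m • X)⁺ ⊓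
        (x n - (4 : ℝ) ^ n • ∑ i ∈ Finset.range n, x i - (2⁻¹ : ℝ) ^ n • X)⁺ = 0 := by
  have hX0 : 0 ≤ X := (smul_nonneg (by positivity) (hx 0)).trans (hX 0)
  have key : ∀ m n, m < n →
      (x m - (4 : ℝ) ^ m • ∑ i ∈ Finset.range m, x i - (2⁻¹ : ℝ) ^ m • X)⁺ ⊓
        (x n - (4 : ℝ) ^ n • ∑ i ∈ Finset.range n, x i - (2⁻¹ : ℝ) ^ n • X)⁺ = 0 := by
    intro m n hmn
    refine inf_eq_zero_of_le (posPart_nonneg _) (posPart_nonneg _) (posPart_mono ?_)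
      (posPart_mono ?_) (posPart_inf_posPart_smul_sub (x m) (x n) (s := 2 ^ (m + n))
        (one_le_pow₀ (by norm_num)))
    · have h1 : 0 ≤ (4 : ℝ) ^ m • ∑ i ∈ Finset.range m, x i :=
        smul_nonneg (by positivity) (Finset.sum_nonneg fun i _ => hx i)
      have h2 : ((2 : ℝ) ^ (m + n))⁻¹ • x n ≤ (2⁻¹ : ℝ) ^ m • X := by
        rw [pow_add, mul_inv, mul_smul, ← inv_pow, ← inv_pow]
        exact smul_le_smul_of_nonneg_left (hX n) (by positivity)
      calc _ ≤ x m - 0 - ((2 : ℝ) ^ (m + n))⁻¹ • x n := by gcongr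
        _ = _ := by rw [sub_zero]
    · have h1 : 0 ≤ (2⁻¹ : ℝ) ^ n • X := smul_nonneg (by positivity) hX0
      have h2 : (2 : ℝ) ^ (m + n) • x m ≤ (4 : ℝ) ^ n • ∑ i ∈ Finset.range n, x i := by
        calc (2 : ℝ) ^ (m + n) • x m ≤ (4 : ℝ) ^ n • x m := by
              refine smul_le_smul_of_nonneg_right ?_ (hx m)
              rw [show (4 : ℝ) = 2 ^ 2 by norm_num, ← pow_mul]
              exact pow_le_pow_right₀ (by norm_num) (by omega)
          _ ≤ _ := by
              refine smul_le_smul_of_nonneg_left ?_ (by positivity)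
              exact Finset.single_le_sum (fun i _ => hx i) (Finset.mem_range.2 hmn)
      calc _ ≤ x n - (2 : ℝ) ^ (m + n) • x m - 0 := by gcongr
        _ = _ := by rw [sub_zero]
  intro m n hmn
  rcases hmn.lt_or_gt with h | h
  · exact key m n h
  · rw [inf_comm]; exact key n m h

end VectorLattice

/-! ### The dual of a Banach lattice is a vector lattice -/

section Extension

variable {E : Type*} [NormedAddCommGroup E] [NormedSpace ℝ E] [Lattice E] [IsOrderedAddMonoid E]
  [HasSolidNorm E]

theorem norm_le_norm_of_nonneg_of_le {E : Type*} [NormedAddCommGroup E] [Lattice E]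
    [IsOrderedAddMonoid E] [HasSolidNorm E] {x y : E} (hx : 0 ≤ x) (hxy : x ≤ y) : ‖x‖ ≤ ‖y‖ :=
  norm_le_norm_of_abs_le_abs (by rwa [abs_of_nonneg hx, abs_of_nonneg (hx.trans hxy)])

theorem norm_posPart_le {E : Type*} [NormedAddCommGroup E] [Lattice E]
    [IsOrderedAddMonoid E] [HasSolidNorm E] (x : E) : ‖x⁺‖ ≤ ‖x‖ := by
  rw [← norm_abs_eq_norm x]
  exact norm_le_norm_of_nonneg_of_le (posPart_nonneg x) (sup_le (le_abs_self x) (abs_nonneg x))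

theorem norm_negPart_le {E : Type*} [NormedAddCommGroup E] [Lattice E]
    [IsOrderedAddMonoid E] [HasSolidNorm E] (x : E) : ‖x⁻‖ ≤ ‖x‖ := by
  rw [← norm_neg x, ← posPart_neg]
  exact norm_posPart_le _

/-- A norm bounded additive map on the positive cone extends to a bounded operator. -/
theorem exists_clm_of_additive_on_cone {H : Type*} [NormedAddCommGroup H] [NormedSpace ℝ H]
    (p : E → H) (C : ℝ) (hadd : ∀ x y, 0 ≤ x → 0 ≤ y → p (x + y) = p x + p y)
    (hC : ∀ x, 0 ≤ x → ‖p x‖ ≤ C * ‖x‖) : ∃ L : E →L[ℝ] H, ∀ x, 0 ≤ x → L x = p x := by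
  have h0 : p 0 = 0 := by simpa using hadd 0 0 le_rfl le_rfl
  have hsub : ∀ a b, 0 ≤ a → 0 ≤ b → p (a - b)⁺ - p (a - b)⁻ = p a - p b := by
    intro a b ha hb
    have h1 : (a - b)⁺ + b = (a - b)⁻ + a :=
      (sub_eq_sub_iff_add_eq_add.1 (posPart_sub_negPart (a - b))).trans (add_comm _ _)
    have h2 := congrArg p h1
    rw [hadd _ _ (posPart_nonneg _) hb, hadd _ _ (negPart_nonneg _) ha] at h2
    rw [sub_eq_sub_iff_add_eq_add, h2, add_comm]
  let A : E →+ H := AddMonoidHom.mk' (fun x => p x⁺ - p x⁻) fun x y => by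
    have h1 : x + y = (x⁺ + y⁺) - (x⁻ + y⁻) := by
      rw [add_sub_add_comm, posPart_sub_negPart, posPart_sub_negPart]
    rw [h1, hsub _ _ (add_nonneg (posPart_nonneg _) (posPart_nonneg _))
      (add_nonneg (negPart_nonneg _) (negPart_nonneg _)),
      hadd _ _ (posPart_nonneg _) (posPart_nonneg _),
      hadd _ _ (negPart_nonneg _) (negPart_nonneg _), add_sub_add_comm]
  have hcont : Continuous A := by
    refine AddMonoidHomClass.continuous_of_bound A (|C| + |C|) fun x => ?_
    have hb : ∀ z : E, 0 ≤ z → ‖z‖ ≤ ‖x‖ → ‖p z‖ ≤ |C| * ‖x‖ := fun z hz hzx =>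
      (hC z hz).trans (mul_le_mul (le_abs_self C) hzx (norm_nonneg _) (abs_nonneg _))
    calc ‖A x‖ ≤ ‖p x⁺‖ + ‖p x⁻‖ := norm_sub_le _ _
      _ ≤ _ := by
        rw [add_mul]
        exact add_le_add (hb _ (posPart_nonneg _) (norm_posPart_le x))
          (hb _ (negPart_nonneg _) (norm_negPart_le x))
  refine ⟨A.toRealLinearMap hcont, fun x hx => ?_⟩
  change p x⁺ - p x⁻ = p x
  rw [posPart_of_nonneg hx, negPart_of_nonneg hx, h0, sub_zero]

end Extension

section DualLattice

variable {E : Type*} [NormedAddCommGroup E] [NormedSpace ℝ E] [Lattice E] [IsOrderedAddMonoid E]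

theorem dual_apply_mono {f : StrongDual ℝ E} (hf : 0 ≤ f) {x y : E} (h : x ≤ y) : f x ≤ f y := by
  have := hf (y - x) (sub_nonneg.2 h)
  rw [map_sub] at this
  simpa using this

theorem dual_apply_nonneg {f : StrongDual ℝ E} (hf : 0 ≤ f) {x : E} (h : 0 ≤ x) : 0 ≤ f x := by
  simpa using hf x h

theorem dual_abs_apply_le {f : StrongDual ℝ E} (hf : 0 ≤ f) (x : E) : |f x| ≤ f |x| :=
  abs_le'.2 ⟨dual_apply_mono hf (le_abs_self x), by
    rw [← map_neg]; exact dual_apply_mono hf (neg_le_abs x)⟩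

instance : IsOrderedAddMonoid (StrongDual ℝ E) where
  add_le_add_left f g h k x hx := by
    simpa using h x hx

instance : IsOrderedModule ℝ (StrongDual ℝ E) where
  smul_le_smul_of_nonneg_left c hc f g h x hx := by
    simpa using mul_le_mul_of_nonneg_left (h x hx) hc
  smul_le_smul_of_nonneg_right f hf c d h x hx := by
    simpa using mul_le_mul_of_nonneg_right h (dual_apply_nonneg hf hx)

variable [HasSolidNorm E]

/-- The Riesz–Kantorovich formula: the positive part of a functional exists, and its value at
`x ≥ 0` is the supremum of the values of the functional on the order interval `[0, x]`. -/
theorem exists_dual_posPart (f : StrongDual ℝ E) :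
    ∃ p : StrongDual ℝ E, ∀ x, 0 ≤ x → IsLUB (f '' Set.Icc 0 x) (p x) := by
  have hbdd : ∀ x, BddAbove (f '' Set.Icc 0 x) := by
    rintro x
    refine ⟨‖f‖ * ‖x‖, ?_⟩
    rintro _ ⟨y, hy, rfl⟩
    exact (le_abs_self _).trans ((f.le_opNorm y).trans
      (mul_le_mul_of_nonneg_left (norm_le_norm_of_nonneg_of_le hy.1 hy.2) (norm_nonneg f)))
  have hne : ∀ x : E, 0 ≤ x → (f '' Set.Icc 0 x).Nonempty := fun x hx =>
    ⟨_, 0, ⟨le_rfl, hx⟩, rfl⟩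
  have hlub : ∀ x : E, 0 ≤ x → IsLUB (f '' Set.Icc 0 x) (sSup (f '' Set.Icc 0 x)) := fun x hx =>
    isLUB_csSup (hne x hx) (hbdd x)
  obtain ⟨p, hp⟩ := exists_clm_of_additive_on_cone (fun x => sSup (f '' Set.Icc 0 x)) ‖f‖
    (fun x y hx hy => by
      refine (hlub (x + y) (add_nonneg hx hy)).unique ?_
      have := (hlub x hx).add (hlub y hy)
      convert this using 1
      ext r
      constructor
      · rintro ⟨z, hz, rfl⟩
        refine Set.mem_add.2 ⟨f (z ⊓ x), ⟨_, ⟨le_inf hz.1 hx, inf_le_right⟩, rfl⟩, f (z - z ⊓ x),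
          ⟨_, ⟨sub_nonneg.2 inf_le_left, ?_⟩, rfl⟩, by rw [← map_add]; congr 1; abel⟩
        rw [sub_inf, sub_self]
        exact sup_le hy (sub_le_iff_le_add'.2 hz.2)
      · intro h
        obtain ⟨_, ⟨a, ha, rfl⟩, _, ⟨b, hb, rfl⟩, rfl⟩ := Set.mem_add.1 h
        exact ⟨a + b, ⟨add_nonneg ha.1 hb.1, add_le_add ha.2 hb.2⟩, map_add _ _ _⟩)
    (fun x hx => by
      rw [Real.norm_of_nonneg ((hlub x hx).1 ⟨0, ⟨le_rfl, hx⟩, map_zero f⟩)]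
      refine (hlub x hx).2 ?_
      rintro _ ⟨y, hy, rfl⟩
      exact (le_abs_self _).trans ((f.le_opNorm y).trans
        (mul_le_mul_of_nonneg_left (norm_le_norm_of_nonneg_of_le hy.1 hy.2) (norm_nonneg f))))
  exact ⟨p, fun x hx => by rw [hp x hx]; exact hlub x hx⟩

/-- The positive part of a functional, given by the Riesz–Kantorovich formula. -/
noncomputable def dualPosPart (f : StrongDual ℝ E) : StrongDual ℝ E :=
  (exists_dual_posPart f).choose

theorem isLUB_dualPosPart (f : StrongDual ℝ E) {x : E} (hx : 0 ≤ x) :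
    IsLUB (f '' Set.Icc 0 x) (dualPosPart f x) :=
  (exists_dual_posPart f).choose_spec x hx

theorem le_dualPosPart (f : StrongDual ℝ E) : f ≤ dualPosPart f := fun x hx =>
  (isLUB_dualPosPart f hx).1 ⟨x, ⟨hx, le_rfl⟩, rfl⟩

theorem dualPosPart_nonneg (f : StrongDual ℝ E) : 0 ≤ dualPosPart f := fun _ hx =>
  (isLUB_dualPosPart f hx).1 ⟨0, ⟨le_rfl, hx⟩, map_zero f⟩

theorem dualPosPart_le {f g : StrongDual ℝ E} (hfg : f ≤ g) (hg : 0 ≤ g) : dualPosPart f ≤ g := by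
  intro x hx
  refine (isLUB_dualPosPart f hx).2 ?_
  rintro _ ⟨y, hy, rfl⟩
  exact (hfg y hy.1).trans (dual_apply_mono hg hy.2)

/-- The dual of a Banach lattice is a lattice for its canonical order. -/
noncomputable instance dualLattice : Lattice (StrongDual ℝ E) where
  __ := (dualPartialOrder : PartialOrder (StrongDual ℝ E))
  sup f g := g + dualPosPart (f - g)
  inf f g := f - dualPosPart (f - g)
  le_sup_left f g := sub_le_iff_le_add'.1 (le_dualPosPart (f - g))
  le_sup_right _ _ := le_add_of_nonneg_right (dualPosPart_nonneg _)
  sup_le _ g _ hf hg := le_sub_iff_add_le'.1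
    (dualPosPart_le (sub_le_sub_right hf g) (sub_nonneg.2 hg))
  inf_le_left _ _ := sub_le_self _ (dualPosPart_nonneg _)
  inf_le_right f g := sub_le_comm.1 (le_dualPosPart (f - g))
  le_inf _ f _ hf hg := le_sub_comm.1
    (dualPosPart_le (sub_le_sub_left hg f) (sub_nonneg.2 hf))

theorem dualDisjoint_iff (f g : StrongDual ℝ E) : DualDisjoint f g ↔ |f| ⊓ |g| = 0 := by
  constructor
  · rintro ⟨a, b, ha, hb, hab⟩
    rw [show |f| = a from isLUB_pair.unique ha, show |g| = b from isLUB_pair.unique hb]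
    exact isGLB_pair.unique hab
  · intro h
    exact ⟨|f|, |g|, isLUB_pair, isLUB_pair, h ▸ isGLB_pair⟩

theorem exists_dual_posPart_lt (f : StrongDual ℝ E) {x : E} (hx : 0 ≤ x) {ε : ℝ} (hε : 0 < ε) :
    ∃ y, 0 ≤ y ∧ y ≤ x ∧ f⁺ x < f y + ε := by
  have h1 : f⁺ = dualPosPart f := by
    change 0 + dualPosPart (f - 0) = _
    rw [zero_add, sub_zero]
  obtain ⟨_, ⟨y, hy, rfl⟩, h, -⟩ := (isLUB_dualPosPart f hx).exists_between
    (sub_lt_self (dualPosPart f x) hε)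
  exact ⟨y, hy.1, hy.2, by rw [h1]; linarith⟩

/-- Disjoint positive functionals are almost carried by complementary parts of any `x ≥ 0`. -/
theorem exists_split_of_dual_inf_eq_zero {f g : StrongDual ℝ E} (h : f ⊓ g = 0) {x : E}
    (hx : 0 ≤ x) {ε : ℝ} (hε : 0 < ε) : ∃ y, 0 ≤ y ∧ y ≤ x ∧ f (x - y) + g y < ε := by
  obtain ⟨y, hy0, hyx, hy⟩ := exists_dual_posPart_lt (f - g) hx hε
  refine ⟨y, hy0, hyx, ?_⟩
  have h1 : (f - g)⁺ = f := by
    have := inf_eq_sub_posPart_sub f g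
    rw [h] at this
    exact (sub_eq_zero.1 this.symm).symm
  rw [h1] at hy
  simp only [sub_apply, map_sub] at hy ⊢
  linarith

/-- The modulus of a functional is, up to a factor, attained on positive elements: by the
Riesz–Kantorovich formula for `|f| = 2 f⁺ - f`, either a maximizer `y` for `f⁺` or `x` itself will
do. -/
theorem exists_dual_abs_lt (f : StrongDual ℝ E) {x : E} (hx : 0 ≤ x) {ε : ℝ} (hε : 0 < ε) :
    ∃ y, 0 ≤ y ∧ y ≤ x ∧ |f| x < 4 * |f y| + ε := by
  obtain ⟨y, hy0, hyx, hy⟩ := exists_dual_posPart_lt f hx (half_pos hε)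
  have h1 : |f| = f⁺ + f⁺ - f := by
    rw [← posPart_add_negPart, eq_sub_iff_add_eq, add_assoc,
      ← sub_eq_iff_eq_add'.1 (posPart_sub_negPart f)]
  have h2 : |f| x < 2 * f y - f x + ε := by
    rw [h1]
    simp only [sub_apply, add_apply]
    linarith
  by_cases h3 : |f x| ≤ 2 * |f y|
  · exact ⟨y, hy0, hyx, by linarith [le_abs_self (f y), neg_abs_le (f x)]⟩
  · exact ⟨x, hx, le_rfl, by linarith [le_abs_self (f y), neg_abs_le (f x), abs_nonneg (f x)]⟩

theorem abs_dual_apply_le (f : StrongDual ℝ E) (x : E) : |f x| ≤ |f| |x| := by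
  have hpos : ∀ z : E, 0 ≤ z → |f z| ≤ |f| z := fun z hz =>
    abs_le'.2 ⟨le_abs_self f z hz, by simpa using neg_le_abs f z hz⟩
  calc |f x| = |f x⁺ - f x⁻| := by rw [← map_sub, posPart_sub_negPart]
    _ ≤ |f x⁺| + |f x⁻| := abs_sub _ _
    _ ≤ |f| x⁺ + |f| x⁻ := add_le_add (hpos _ (posPart_nonneg x)) (hpos _ (negPart_nonneg x))
    _ = |f| |x| := by rw [← map_add, posPart_add_negPart]

theorem abs_dual_apply_le_norm (f : StrongDual ℝ E) {x : E} (hx : 0 ≤ x) :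
    |f| x ≤ 4 * (‖f‖ * ‖x‖) := by
  refine le_of_forall_pos_le_add fun ε hε => ?_
  obtain ⟨y, hy0, hyx, hy⟩ := exists_dual_abs_lt f hx hε
  have h1 : |f y| ≤ ‖f‖ * ‖x‖ := (f.le_opNorm y).trans
    (mul_le_mul_of_nonneg_left (norm_le_norm_of_nonneg_of_le hy0 hyx) (norm_nonneg f))
  linarith

end DualLattice

/-! ### Functionals dominated by sublinear maps -/

section HahnBanach

variable {E : Type*} [NormedAddCommGroup E] [NormedSpace ℝ E]

/-- A form of the Hahn–Banach theorem: a linear functional `ψ` on `V` dominated by `N ∘ L` factors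
through `L` by a functional dominated by `N`. -/
theorem exists_linear_factor_of_le_sublinear {V : Type*} [AddCommGroup V] [Module ℝ V]
    (L : V →ₗ[ℝ] E) (ψ : V →ₗ[ℝ] ℝ) (N : E → ℝ)
    (N_hom : ∀ c : ℝ, 0 < c → ∀ x, N (c • x) = c * N x) (N_add : ∀ x y, N (x + y) ≤ N x + N y)
    (h : ∀ v, ψ v ≤ N (L v)) : ∃ g : E →ₗ[ℝ] ℝ, (∀ v, g (L v) = ψ v) ∧ ∀ x, g x ≤ N x := by
  have N0 : N 0 = 0 := by
    have := N_hom 2 (by norm_num) 0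
    rw [smul_zero] at this
    linarith
  have hker : LinearMap.ker L ≤ LinearMap.ker ψ := by
    intro v hv
    rw [LinearMap.mem_ker] at hv ⊢
    have h1 := h v
    have h2 := h (-v)
    rw [hv, N0] at h1
    rw [map_neg, map_neg, hv, neg_zero, N0] at h2
    linarith
  let φ : LinearMap.range L →ₗ[ℝ] ℝ :=
    (LinearMap.ker L).liftQ ψ hker ∘ₗ L.quotKerEquivRange.symm.toLinearMap
  have hφ : ∀ v, φ ⟨L v, v, rfl⟩ = ψ v := fun v => by
    have : L.quotKerEquivRange.symm ⟨L v, v, rfl⟩ = (LinearMap.ker L).mkQ v := by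
      rw [LinearEquiv.symm_apply_eq]; rfl
    simp only [φ, LinearMap.comp_apply, LinearEquiv.coe_coe, this]
    rfl
  obtain ⟨g, hg1, hg2⟩ := exists_extension_of_le_sublinear ⟨LinearMap.range L, φ⟩ N N_hom N_add
    (by rintro ⟨_, v, rfl⟩; exact (hφ v).trans_le (h v))
  exact ⟨g, fun v => (hg1 ⟨L v, v, rfl⟩).trans (hφ v), hg2⟩

/-- A positive functional norming the positive part of `y` and vanishing on the negative part. -/
theorem exists_positive_functional_norm_posPart [Lattice E] [IsOrderedAddMonoid E]
    [IsOrderedModule ℝ E] [HasSolidNorm E] (y : E) :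
    ∃ φ : StrongDual ℝ E, 0 ≤ φ ∧ ‖φ‖ ≤ 1 ∧ φ y = ‖y⁺‖ := by
  have hsmul : ∀ c : ℝ, 0 < c → ∀ x : E, (c • x)⁺ = c • x⁺ := by
    intro c hc x
    refine le_antisymm (sup_le (smul_le_smul_of_nonneg_left (le_posPart x) hc.le)
      (smul_nonneg hc.le (posPart_nonneg x))) ?_
    rw [← le_inv_smul_iff_of_pos hc]
    refine sup_le ?_ (smul_nonneg (by positivity) (posPart_nonneg _))
    rw [le_inv_smul_iff_of_pos hc]
    exact le_posPart _
  obtain ⟨g, hg1, hg2⟩ := exists_linear_factor_of_le_sublinear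
    (LinearMap.toSpanSingleton ℝ E y) (LinearMap.toSpanSingleton ℝ ℝ ‖y⁺‖) (fun x => ‖x⁺‖)
    (fun c hc x => by
      simp only [hsmul c hc x, norm_smul, Real.norm_of_nonneg hc.le])
    (fun x z => by
      refine (norm_le_norm_of_nonneg_of_le (posPart_nonneg _) ?_).trans (norm_add_le _ _)
      exact sup_le (add_le_add (le_posPart x) (le_posPart z))
        (add_nonneg (posPart_nonneg x) (posPart_nonneg z)))
    (fun c => by
      simp only [LinearMap.toSpanSingleton_apply, smul_eq_mul]
      rcases lt_or_ge 0 c with hc | hc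
      · rw [hsmul c hc, norm_smul, Real.norm_of_nonneg hc.le]
      · exact (mul_nonpos_of_nonpos_of_nonneg hc (norm_nonneg _)).trans (norm_nonneg _))
  have hle : ∀ x, g x ≤ ‖x‖ := fun x => (hg2 x).trans (norm_posPart_le x)
  refine ⟨g.mkContinuous 1 fun x => ?_, fun x hx => ?_,
    LinearMap.mkContinuous_norm_le _ zero_le_one _, ?_⟩
  · rw [one_mul]
    refine abs_le'.2 ⟨hle x, ?_⟩
    simpa using hle (-x)
  · have := hg2 (-x)
    rw [posPart_eq_zero.2 (neg_nonpos.2 hx), norm_zero, map_neg] at this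
    simpa using this
  · simpa using hg1 1

end HahnBanach

/-! ### Weakly null sequences -/

section Weak

variable {X : Type*} [NormedAddCommGroup X] [NormedSpace ℝ X]

theorem WeaklyNull.comp {x : ℕ → X} (hx : WeaklyNull x) {n : ℕ → ℕ} (hn : StrictMono n) :
    WeaklyNull fun k => x (n k) := fun f => (hx f).comp hn.tendsto_atTop

theorem WeakStarNull.comp {f : ℕ → StrongDual ℝ X} (hf : WeakStarNull f) {n : ℕ → ℕ}
    (hn : StrictMono n) : WeakStarNull fun k => f (n k) := fun x => (hf x).comp hn.tendsto_atTop

/-- A weakly bounded set is norm bounded. -/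
theorem exists_norm_le_of_forall_dual_bounded {W : Set X}
    (h : ∀ f : StrongDual ℝ X, ∃ C, ∀ x ∈ W, |f x| ≤ C) : ∃ C, ∀ x ∈ W, ‖x‖ ≤ C := by
  obtain ⟨C, hC⟩ := banach_steinhaus
    (g := fun x : W => NormedSpace.inclusionInDoubleDual ℝ X x) fun f => by
      obtain ⟨C, hC⟩ := h f
      exact ⟨C, fun x => hC x x.2⟩
  refine ⟨C, fun x hx => ?_⟩
  have := hC ⟨x, hx⟩
  rwa [show ‖NormedSpace.inclusionInDoubleDual ℝ X x‖ = ‖x‖ from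
    (NormedSpace.inclusionInDoubleDualLi (𝕜 := ℝ) (E := X)).norm_map x] at this

theorem WeaklyNull.exists_norm_le {x : ℕ → X} (hx : WeaklyNull x) : ∃ C, ∀ n, ‖x n‖ ≤ C := by
  obtain ⟨C, hC⟩ := exists_norm_le_of_forall_dual_bounded (W := Set.range x) fun f => by
    obtain ⟨C, hC⟩ := (hx f).norm.bddAbove_range
    refine ⟨C, ?_⟩
    rintro _ ⟨n, rfl⟩
    exact hC ⟨n, rfl⟩
  exact ⟨C, fun n => hC _ ⟨n, rfl⟩⟩

theorem WeakStarNull.exists_norm_le [CompleteSpace X] {f : ℕ → StrongDual ℝ X}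
    (hf : WeakStarNull f) : ∃ C, ∀ n, ‖f n‖ ≤ C :=
  banach_steinhaus fun x => by
    obtain ⟨C, hC⟩ := (hf x).norm.bddAbove_range
    exact ⟨C, fun n => hC ⟨n, rfl⟩⟩

theorem RelWeaklyCompact.exists_norm_le {W : Set X} (hW : RelWeaklyCompact W) :
    ∃ C, ∀ x ∈ W, ‖x‖ ≤ C := by
  refine exists_norm_le_of_forall_dual_bounded fun f => ?_
  have hcont : Continuous fun z : WeakSpace ℝ X => f ((toWeakSpace ℝ X).symm z) :=
    WeakBilin.eval_continuous (topDualPairing ℝ X).flip f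
  obtain ⟨C, hC⟩ := (IsCompact.image hW hcont).isBounded.exists_norm_le
  exact ⟨C, fun x hx => hC _ ⟨_, subset_closure ⟨x, hx, rfl⟩, rfl⟩⟩

/-- The terms of a weakly null sequence form, together with `0`, a weakly compact set. -/
theorem WeaklyNull.relWeaklyCompact_range {x : ℕ → X} (hx : WeaklyNull x) :
    RelWeaklyCompact (Set.range x) := by
  have hinj : Function.Injective (topDualPairing ℝ X).flip := by
    intro a b hab
    by_contra hne
    obtain ⟨f, hf⟩ := SeparatingDual.exists_separating_of_ne (R := ℝ) hne
    exact hf (LinearMap.congr_fun hab f)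
  have : T2Space (WeakSpace ℝ X) := (WeakBilin.isEmbedding hinj).t2Space
  have hlim : Tendsto (fun n => toWeakSpace ℝ X (x n)) atTop (𝓝 0) := by
    rw [show (0 : WeakSpace ℝ X) = toWeakSpace ℝ X 0 from (map_zero _).symm]
    refine (WeakBilin.tendsto_iff_forall_eval_tendsto (topDualPairing ℝ X).flip hinj).2 fun f => ?_
    have := hx f
    rw [← map_zero f] at this
    exact this
  refine hlim.isCompact_insert_range.closure_of_subset ?_
  rintro _ ⟨_, ⟨n, rfl⟩, rfl⟩
  exact Set.mem_insert_of_mem _ ⟨n, rfl⟩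

variable [Lattice X] [IsOrderedAddMonoid X] [HasSolidNorm X]

theorem WeaklyNull.of_nonneg {x : ℕ → X}
    (h : ∀ f : StrongDual ℝ X, 0 ≤ f → Tendsto (fun n => f (x n)) atTop (𝓝 0)) :
    WeaklyNull x := by
  intro f
  have := (h f⁺ (posPart_nonneg f)).sub (h f⁻ (negPart_nonneg f))
  rw [sub_zero] at this
  refine this.congr fun n => ?_
  rw [← sub_apply, posPart_sub_negPart]

theorem WeaklyNull.of_nonneg_of_le {x y : ℕ → X} (hy : WeaklyNull y) (hx : ∀ n, 0 ≤ x n)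
    (hxy : ∀ n, x n ≤ y n) : WeaklyNull x :=
  .of_nonneg fun f hf => squeeze_zero (fun n => dual_apply_nonneg hf (hx n))
    (fun n => dual_apply_mono hf (hxy n)) (hy f)

end Weak

section OrderBounded

variable {E : Type*} [NormedAddCommGroup E] [NormedSpace ℝ E] [Lattice E] [IsOrderedAddMonoid E]
  [IsOrderedModule ℝ E] [HasSolidNorm E]
variable {F : Type*} [NormedAddCommGroup F] [NormedSpace ℝ F] [Lattice F] [IsOrderedAddMonoid F]
  [IsOrderedModule ℝ F] [HasSolidNorm F]

theorem OrderBoundedOp.exists_abs_le {E F : Type*} [NormedAddCommGroup E] [NormedSpace ℝ E]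
    [Lattice E] [IsOrderedAddMonoid E] [NormedAddCommGroup F] [NormedSpace ℝ F] [Lattice F]
    [IsOrderedAddMonoid F] {T : E →L[ℝ] F} (hT : OrderBoundedOp T) (v : E) :
    ∃ w, 0 ≤ w ∧ ∀ z, |z| ≤ v → |T z| ≤ w := by
  obtain ⟨c, d, hcd⟩ := hT (-v) v
  refine ⟨|c| ⊔ |d|, (abs_nonneg c).trans le_sup_left, fun z hz => ?_⟩
  have h := hcd ⟨z, ⟨neg_le.1 ((neg_le_abs z).trans hz), (le_abs_self z).trans hz⟩, rfl⟩
  refine abs_le'.2 ⟨h.2.trans ((le_abs_self d).trans le_sup_right), ?_⟩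
  exact (neg_le_neg h.1).trans ((neg_le_abs c).trans le_sup_left)

/-- An order bounded operator is bounded, measured by a functional on the bounds of the
images of order intervals. Otherwise bad order intervals `[-v k, v k]` with `∑ ‖v k‖ < ∞` all lie
in one order interval, whose image has a bound that is bad for every `k`. -/
theorem OrderBoundedOp.exists_uniform_bound [CompleteSpace E] {F : Type*} [NormedAddCommGroup F]
    [NormedSpace ℝ F] [Lattice F] [IsOrderedAddMonoid F] [IsOrderedModule ℝ F] {T : E →L[ℝ] F}
    (hT : OrderBoundedOp T) (φ : StrongDual ℝ F) :
    ∃ C : ℝ, 0 ≤ C ∧ ∀ v, 0 ≤ v → ∃ w, (∀ z, |z| ≤ v → |T z| ≤ w) ∧ φ w ≤ C * ‖v‖ := by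
  by_contra! hcon
  have key : ∀ k : ℕ, ∃ v : E, 0 ≤ v ∧ ‖v‖ ≤ (2⁻¹ : ℝ) ^ k ∧
      ∀ w, (∀ z, |z| ≤ v → |T z| ≤ w) → (k : ℝ) ≤ φ w := by
    intro k
    obtain ⟨v, hv0, hv⟩ := hcon (k * 2 ^ k) (by positivity)
    have hvn : 0 < ‖v‖ := by
      rcases (norm_nonneg v).eq_or_lt with h | h
      · have hv' : v = 0 := norm_eq_zero.1 h.symm
        have := hv 0 fun z hz => by
          have hz' : |z| ≤ |(0 : E)| := by simpa [hv'] using hz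
          rw [norm_le_zero_iff.1 ((norm_le_norm_of_abs_le_abs hz').trans norm_zero.le)]
          simp
        rw [map_zero, ← h, mul_zero] at this
        exact absurd this (lt_irrefl _)
      · exact h
    set c : ℝ := (2⁻¹ : ℝ) ^ k * ‖v‖⁻¹ with hc
    have hc0 : 0 < c := by positivity
    refine ⟨c • v, smul_nonneg hc0.le hv0, ?_, fun w hw => ?_⟩
    · rw [norm_smul, Real.norm_of_nonneg hc0.le, hc, mul_assoc, inv_mul_cancel₀ hvn.ne', mul_one]
    · have h1 := hv (c⁻¹ • w) fun z hz => by
        rw [le_inv_smul_iff_of_pos hc0]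
        have := hw (c • z) (by
          rw [abs_real_smul, abs_of_pos hc0]
          exact smul_le_smul_of_nonneg_left hz hc0.le)
        rwa [map_smul, abs_real_smul, abs_of_pos hc0] at this
      rw [map_smul, smul_eq_mul, lt_inv_mul_iff₀ hc0, hc] at h1
      refine le_of_lt (lt_of_le_of_lt (le_of_eq ?_) h1)
      rw [inv_pow]
      field_simp
  choose v hv0 hvn hv using key
  have hsum : Summable v :=
    Summable.of_norm_bounded (summable_geometric_of_lt_one (by norm_num) (by norm_num)) hvn
  obtain ⟨w, -, hw⟩ := hT.exists_abs_le (∑' k, v k)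
  obtain ⟨k, hk⟩ := exists_nat_gt (φ w)
  exact absurd (hv k w fun z hz => hw z (hz.trans (hsum.le_tsum k fun j _ => hv0 j)))
    (not_le.2 hk)

/-- Along a disjoint weakly null sequence `(x n)`, the moduli `|T (x n)|` are weakly null: as
`∑ |a i| |T (x i)|` is bounded by every bound of `T` on the order interval of `∑ a i x i`, the
rule `x n ↦ φ |T (x n)|` extends to a bounded functional. -/
theorem OrderBoundedOp.weaklyNull_abs [CompleteSpace E] {T : E →L[ℝ] F} (hT : OrderBoundedOp T)
    {x : ℕ → E} (hd : DisjointSeq x) (hx : WeaklyNull x) : WeaklyNull fun n => |T (x n)| := by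
  refine .of_nonneg fun φ hφ => ?_
  obtain ⟨C, hC0, hC⟩ := hT.exists_uniform_bound φ
  obtain ⟨g, hg1, hg2⟩ := exists_linear_factor_of_le_sublinear
    (Finsupp.linearCombination ℝ x) (Finsupp.linearCombination ℝ fun n => φ |T (x n)|)
    (fun y => C * ‖y‖)
    (fun c hc y => by rw [norm_smul, Real.norm_of_nonneg hc.le]; ring)
    (fun y z => by
      rw [← mul_add]
      exact mul_le_mul_of_nonneg_left (norm_add_le y z) hC0)
    (fun a => by
      obtain ⟨w, hw, hφw⟩ := hC |Finsupp.linearCombination ℝ x a| (abs_nonneg _)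
      rw [norm_abs_eq_norm] at hφw
      refine le_trans ?_ hφw
      have hsum : ∑ i ∈ a.support, |T (a i • x i)| ≤ w := by
        refine sum_abs_le_of_forall_signs _ _ fun σ hσ => ?_
        refine le_trans ?_ (hw (∑ i ∈ a.support, σ i • a i • x i) ?_)
        · rw [map_sum]
          simp only [map_zsmul]
          exact le_abs_self _
        · -- disjointness makes the modulus of the sum independent of the signs `σ`
          have hdis : ∀ c : ℕ → ℝ, ∀ i ∈ a.support, ∀ j ∈ a.support, i ≠ j →
              |c i • x i| ⊓ |c j • x j| = 0 := by
            intro c i _ j _ hij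
            rw [abs_real_smul, abs_real_smul]
            refine inf_smul_eq_zero (smul_nonneg (abs_nonneg _) (abs_nonneg _)) (abs_nonneg _) ?_
              (abs_nonneg _)
            rw [inf_comm]
            exact inf_smul_eq_zero (abs_nonneg _) (abs_nonneg _) (hd hij.symm) (abs_nonneg _)
          rw [Finsupp.linearCombination_apply, Finsupp.sum, abs_sum_of_disjoint _ _ (hdis a)]
          simp only [← Int.cast_smul_eq_zsmul ℝ, smul_smul]
          rw [abs_sum_of_disjoint _ _ (hdis fun i => (σ i : ℝ) * a i)]
          refine le_of_eq (Finset.sum_congr rfl fun i _ => ?_)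
          rw [abs_real_smul, abs_real_smul, abs_mul]
          rcases hσ i with h | h <;> simp [h]
      refine le_trans ?_ (dual_apply_mono hφ hsum)
      rw [map_sum, Finsupp.linearCombination_apply, Finsupp.sum]
      refine Finset.sum_le_sum fun i _ => ?_
      rw [map_smul, abs_real_smul, map_smul, smul_eq_mul, smul_eq_mul]
      exact mul_le_mul_of_nonneg_right (le_abs_self _) (dual_apply_nonneg hφ (abs_nonneg _)))
  have hlim := hx (g.mkContinuous C fun y => abs_le'.2 ⟨hg2 y, by simpa using hg2 (-y)⟩)
  refine hlim.congr fun n => ?_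
  have := hg1 (Finsupp.single n 1)
  simpa using this

theorem DisjointSeq.weaklyNull_abs [CompleteSpace E] {x : ℕ → E} (hd : DisjointSeq x)
    (hx : WeaklyNull x) : WeaklyNull fun n => |x n| :=
  OrderBoundedOp.weaklyNull_abs (T := ContinuousLinearMap.id ℝ E)
    (fun a b => ⟨a, b, by simp⟩) hd hx

end OrderBounded

/-! ### Disjoint sequences of functionals -/

section Selection

theorem exists_strictMono_chain {P : ℕ → ℕ → Prop} (h : ∀ m, ∃ n, m < n ∧ P m n) :
    ∃ f : ℕ → ℕ, StrictMono f ∧ ∀ k, P (f k) (f (k + 1)) := by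
  choose next h1 h2 using h
  exact ⟨fun k => next^[k] 0, strictMono_nat_of_lt_succ fun k => by
    simp only [Function.iterate_succ_apply']; exact h1 _, fun k => by
    simp only [Function.iterate_succ_apply']; exact h2 _⟩

theorem exists_subseq_of_not_tendsto_zero {a : ℕ → ℝ} (h0 : ∀ n, 0 ≤ a n)
    (h : ¬ Tendsto a atTop (𝓝 0)) :
    ∃ ε, 0 < ε ∧ ∃ n : ℕ → ℕ, StrictMono n ∧ ∀ k, ε ≤ a (n k) := by
  rw [Metric.tendsto_atTop] at h
  push Not at h
  obtain ⟨ε, hε, h⟩ := h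
  obtain ⟨n, hn, hn'⟩ := extraction_of_frequently_atTop (frequently_atTop.2 h)
  refine ⟨ε, hε, n, hn, fun k => ?_⟩
  have := hn' k
  rwa [Real.dist_eq, sub_zero, abs_of_nonneg (h0 _)] at this

theorem pow_smul_sum_subseq_le {G : Type*} [AddCommGroup G] [Module ℝ G] [PartialOrder G]
    [IsOrderedAddMonoid G] [IsOrderedModule ℝ G] {x : ℕ → G} (hx : ∀ i, 0 ≤ x i) {n : ℕ → ℕ}
    (hn : StrictMono n) (k : ℕ) :
    (4 : ℝ) ^ (k + 1) • ∑ i ∈ Finset.range (k + 1), x (n i) ≤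
      (4 : ℝ) ^ (n k + 1) • ∑ i ∈ Finset.range (n k + 1), x i := by
  have h1 : ∑ i ∈ Finset.range (k + 1), x (n i) ≤ ∑ i ∈ Finset.range (n k + 1), x i := by
    rw [← Finset.sum_image (f := x) (g := n) fun a _ b _ h => hn.injective h]
    refine Finset.sum_le_sum_of_subset_of_nonneg ?_ fun i _ _ => hx i
    intro j hj
    obtain ⟨i, hi, rfl⟩ := Finset.mem_image.1 hj
    rw [Finset.mem_range, Nat.lt_succ_iff] at hi ⊢
    exact hn.monotone hi
  refine (smul_le_smul_of_nonneg_left h1 (by positivity)).trans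
    (smul_le_smul_of_nonneg_right ?_ (Finset.sum_nonneg fun i _ => hx i))
  exact pow_le_pow_right₀ (by norm_num) (by have := hn.id_le k; simp at this; omega)

end Selection

section DoddsFremlin

variable {E : Type*} [NormedAddCommGroup E] [NormedSpace ℝ E] [Lattice E] [IsOrderedAddMonoid E]
  [HasSolidNorm E]

/-- If the moduli `|y n|` are weakly null, functionals that are uniformly positive on `y n` can be
made disjoint along a subsequence. Each `φ n` is diminished by a large multiple of the preceding
functionals, which is small at `|y n|` after thinning out, and a small multiple of a common bound.
-/
theorem exists_disjoint_functionals {y : ℕ → E} (hy : WeaklyNull fun n => |y n|)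
    {φ : ℕ → StrongDual ℝ E} (hφ : ∀ n, 0 ≤ φ n) (hφ1 : ∀ n, ‖φ n‖ ≤ 1) {ε : ℝ} (hε : 0 < ε)
    (h : ∀ n, ε ≤ φ n (y n)) :
    ∃ n : ℕ → ℕ, StrictMono n ∧ ∃ g : ℕ → StrongDual ℝ E, (∀ k, 0 ≤ g k) ∧
      (∀ k, g k ≤ φ (n k)) ∧ (Pairwise fun i j => g i ⊓ g j = 0) ∧
      ∀ k, ε / 2 ≤ g k (y (n k)) := by
  obtain ⟨n, hn, hP⟩ := exists_strictMono_chain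
    (P := fun m n => ((4 : ℝ) ^ (m + 1) • ∑ i ∈ Finset.range (m + 1), φ i) |y n| < ε / 4)
    fun m => by
      obtain ⟨n, h1, h2⟩ := ((hy ((4 : ℝ) ^ (m + 1) • ∑ i ∈ Finset.range (m + 1), φ i)).eventually
        (gt_mem_nhds (show 0 < ε / 4 by positivity)) |>.and (eventually_gt_atTop m)).exists
      exact ⟨n, h2, h1⟩
  have hsum : Summable fun i => (2⁻¹ : ℝ) ^ i • φ (n i) := by
    refine Summable.of_norm_bounded (g := fun i => (2⁻¹ : ℝ) ^ i)
      (summable_geometric_of_lt_one (by norm_num) (by norm_num)) fun i => ?_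
    rw [norm_smul, Real.norm_of_nonneg (by positivity)]
    exact mul_le_of_le_one_right (by positivity) (hφ1 _)
  set f : StrongDual ℝ E := ∑' i, (2⁻¹ : ℝ) ^ i • φ (n i) with hf
  have hfle : ∀ i, (2⁻¹ : ℝ) ^ i • φ (n i) ≤ f := by
    intro i x hx
    have hs := hsum.hasSum.mapL (ContinuousLinearMap.apply ℝ ℝ x)
    exact le_hasSum hs i fun j _ =>
      dual_apply_nonneg (f := (2⁻¹ : ℝ) ^ j • φ (n j))
        (smul_nonneg (by positivity) (hφ (n j))) hx
  have hf0 : 0 ≤ f := (smul_nonneg (by positivity) (hφ (n 0))).trans (hfle 0)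
  set r : ℕ → StrongDual ℝ E := fun k =>
    (4 : ℝ) ^ k • ∑ i ∈ Finset.range k, φ (n i) + (2⁻¹ : ℝ) ^ k • f with hr
  have hr0 : ∀ k, 0 ≤ r k := fun k =>
    add_nonneg (smul_nonneg (by positivity) (Finset.sum_nonneg fun i _ => hφ _))
      (smul_nonneg (by positivity) hf0)
  set g : ℕ → StrongDual ℝ E := fun k => (φ (n k) - r k)⁺ with hg
  have hgd : Pairwise fun i j => g i ⊓ g j = 0 := by
    have := pairwise_disjoint_posPart_sub (x := fun i => φ (n i)) (X := f) (fun i => hφ _) hfle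
    simpa only [sub_sub] using this
  have hgle : ∀ k, g k ≤ φ (n k) := fun k => sup_le (sub_le_self _ (hr0 k)) (hφ _)
  obtain ⟨K, hK⟩ := eventually_atTop.1 ((hy.comp hn f).eventually
    (gt_mem_nhds (show 0 < ε / 4 by positivity)))
  have hgy : ∀ k, ε / 2 ≤ g (k + K + 1) (y (n (k + K + 1))) := by
    intro k
    set l := k + K + 1 with hl
    have h1 : (φ (n l) - g l) (y (n l)) ≤ r l |y (n l)| := by
      refine (le_abs_self _).trans ((dual_abs_apply_le (sub_nonneg.2 (hgle l)) _).trans ?_)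
      have : φ (n l) - g l ≤ r l := sub_le_comm.1 (le_posPart _)
      exact this _ (abs_nonneg _)
    have h2 : ((4 : ℝ) ^ l • ∑ i ∈ Finset.range l, φ (n i)) |y (n l)| < ε / 4 :=
      (pow_smul_sum_subseq_le hφ hn (k + K) _ (abs_nonneg _)).trans_lt (hP (k + K))
    have h3 : f |y (n l)| < ε / 4 := hK l (by omega)
    have h4 : ((2⁻¹ : ℝ) ^ l • f) |y (n l)| ≤ f |y (n l)| :=
      mul_le_of_le_one_left (dual_apply_nonneg hf0 (abs_nonneg _))
        (pow_le_one₀ (by norm_num) (by norm_num))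
    have h5 : r l |y (n l)| = ((4 : ℝ) ^ l • ∑ i ∈ Finset.range l, φ (n i)) |y (n l)| +
      ((2⁻¹ : ℝ) ^ l • f) |y (n l)| := rfl
    rw [sub_apply] at h1
    linarith [h (n l)]
  have hshift : StrictMono fun k => k + K + 1 := fun a b hab => by simpa using hab
  exact ⟨_, hn.comp hshift, fun k => g (k + K + 1), fun k => posPart_nonneg _,
    fun k => hgle _, fun i j hij => hgd (hshift.injective.ne hij), hgy⟩

end DoddsFremlin

/-! ### Disjoint elements carrying disjoint functionals -/

section Extraction

variable {E : Type*} [NormedAddCommGroup E] [NormedSpace ℝ E] [Lattice E] [IsOrderedAddMonoid E]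
  [HasSolidNorm E]

/-- A positive functional disjoint from finitely many others is almost carried by a part of `u` on
which these are small. -/
theorem exists_split_finset {g : ℕ → StrongDual ℝ E} (hg0 : ∀ n, 0 ≤ g n) (a : ℕ) (I : Finset ℕ)
    (hd : ∀ i ∈ I, g a ⊓ g i = 0) {u : E} (hu : 0 ≤ u) {η : ℝ} (hη : 0 < η) :
    ∃ b, 0 ≤ b ∧ b ≤ u ∧ g a (u - b) ≤ η ∧ ∀ i ∈ I, g i b ≤ η := by
  classical
  induction I using Finset.induction_on generalizing η with
  | empty => exact ⟨u, hu, le_rfl, by simpa using hη.le, by simp⟩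
  | insert i I _ ih =>
    obtain ⟨b, hb0, hbu, hb, hbI⟩ := ih (fun j hj => hd j (Finset.mem_insert_of_mem hj))
      (half_pos hη)
    obtain ⟨c, hc0, hcb, hc⟩ := exists_split_of_dual_inf_eq_zero
      (hd i (Finset.mem_insert_self i I)) hb0 (half_pos hη)
    have h1 := dual_apply_nonneg (hg0 a) (sub_nonneg.2 hcb)
    have h2 := dual_apply_nonneg (hg0 i) hc0
    refine ⟨c, hc0, hcb.trans hbu, ?_, fun j hj => ?_⟩
    · rw [← sub_add_sub_cancel u b c, map_add]
      linarith
    · rcases Finset.mem_insert.1 hj with rfl | hj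
      · linarith
      · linarith [hbI j hj, dual_apply_mono (hg0 j) hcb]

/-- Finitely many disjoint positive functionals almost live on the parts of a decomposition. -/
theorem exists_decomposition_finset {g : ℕ → StrongDual ℝ E} (hg0 : ∀ n, 0 ≤ g n)
    (hd : Pairwise fun i j => g i ⊓ g j = 0) (I : Finset ℕ) {u : E} (hu : 0 ≤ u) {η : ℝ}
    (hη : 0 < η) :
    ∃ v : ℕ → E, (∀ i, 0 ≤ v i) ∧ ∑ i ∈ I, v i ≤ u ∧ ∀ i ∈ I, g i (u - v i) ≤ η := by
  classical
  induction I using Finset.induction_on generalizing u η with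
  | empty => exact ⟨fun _ => 0, fun _ => le_rfl, by simpa using hu, by simp⟩
  | insert a I ha ih =>
    obtain ⟨b, hb0, hbu, hb, hbI⟩ := exists_split_finset hg0 a I
      (fun i hi => hd fun e => ha (e ▸ hi)) hu (half_pos hη)
    obtain ⟨v, hv0, hvs, hv⟩ := ih (sub_nonneg.2 hbu) (half_pos hη)
    refine ⟨Function.update v a b, fun i => ?_, ?_, fun i hi => ?_⟩
    · by_cases hia : i = a
      · subst hia; simpa using hb0
      · simpa [hia] using hv0 i
    · rw [Finset.sum_insert ha, Function.update_self, Finset.sum_update_of_notMem ha]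
      exact le_sub_iff_add_le'.1 hvs
    · rcases Finset.mem_insert.1 hi with rfl | hi
      · rw [Function.update_self]; linarith
      · rw [Function.update_of_ne (show i ≠ a from fun e => ha (e ▸ hi)),
          show u - v i = b + (u - b - v i) by abel, map_add]
        linarith [hbI i hi, hv i hi]

variable [IsOrderedModule ℝ E]

/-- One step of the extraction: among infinitely many uniformly bounded disjoint functionals there
is one carried by a piece `w` of `u` that carries almost nothing of infinitely many others. -/
theorem exists_extraction_step {g : ℕ → StrongDual ℝ E} (hg0 : ∀ n, 0 ≤ g n)
    (hd : Pairwise fun i j => g i ⊓ g j = 0) {u : E} (hu : 0 ≤ u) {C : ℝ} (hC : ∀ n, g n u ≤ C)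
    {S : Set ℕ} (hS : S.Infinite) {δ : ℝ} (hδ : 0 < δ) :
    ∃ i ∈ S, ∃ w u' : E, 0 ≤ w ∧ w ≤ u ∧ 0 ≤ u' ∧ u' ≤ u ∧ w ⊓ u' = 0 ∧ g i (u - w) ≤ δ ∧
      ∃ S' ⊆ S, S'.Infinite ∧ ∀ j ∈ S', i < j ∧ g j (u - u') ≤ δ := by
  set s : ℝ := max 1 (2 * C / δ) with hs
  have hs1 : 1 ≤ s := le_max_left _ _
  have hs0 : 0 < s := by linarith
  have hsC : s⁻¹ * C ≤ δ / 2 := by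
    rw [inv_mul_le_iff₀ hs0]
    have : 2 * C / δ ≤ s := le_max_right _ _
    rw [div_le_iff₀ hδ] at this
    linarith
  -- the cut-off level `s⁻¹` makes `v i - s⁻¹ u` lose little of `g i`; the price is a factor `s` in
  -- the mass lost by the others; with `N` pieces of `u`, each functional is at
  -- most `C / N` on one of them
  obtain ⟨N, hN⟩ := exists_nat_gt (C / (s⁻¹ * δ))
  rw [div_lt_iff₀ (by positivity)] at hN
  obtain ⟨I, hIS, hIN⟩ := hS.exists_subset_card_eq N
  obtain ⟨v, hv0, hvs, hv⟩ := exists_decomposition_finset hg0 hd I hu (half_pos hδ)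
  have hpig : ∃ i ∈ I, {j | j ∈ S ∧ g j (v i) ≤ s⁻¹ * δ}.Infinite := by
    by_contra! hcon
    have hfin : (⋃ i ∈ I, {j | j ∈ S ∧ g j (v i) ≤ s⁻¹ * δ}).Finite :=
      I.finite_toSet.biUnion fun i hi => hcon i hi
    obtain ⟨j, hjS, hj⟩ := hS.exists_notMem_finite hfin
    simp only [Set.mem_iUnion, not_exists] at hj
    have h1 : ∀ i ∈ I, s⁻¹ * δ ≤ g j (v i) := fun i hi => by
      by_contra! hlt
      exact hj i hi ⟨hjS, hlt.le⟩
    have h2 := Finset.card_nsmul_le_sum I _ _ h1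
    rw [hIN, nsmul_eq_mul, ← map_sum] at h2
    linarith [dual_apply_mono (hg0 j) hvs, hC j]
  obtain ⟨i, hiI, hi⟩ := hpig
  have hvu : v i ≤ u := (Finset.single_le_sum (fun j _ => hv0 j) hiI).trans hvs
  have hsu : 0 ≤ s⁻¹ • u := smul_nonneg (by positivity) hu
  have hsv : 0 ≤ s • v i := smul_nonneg hs0.le (hv0 i)
  refine ⟨i, hIS hiI, (v i - s⁻¹ • u)⁺, (u - s • v i)⁺, posPart_nonneg _,
    sup_le ((sub_le_self _ hsu).trans hvu) hu, posPart_nonneg _, sup_le (sub_le_self _ hsv) hu,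
    posPart_inf_posPart_smul_sub _ _ hs1, ?_, _, ?_, hi.sdiff (Set.finite_Iic i), ?_⟩
  · have h1 : u - (v i - s⁻¹ • u)⁺ ≤ (u - v i) + s⁻¹ • u := by
      rw [sub_le_comm]
      refine le_trans (le_of_eq ?_) (le_posPart _)
      abel
    have h2 := dual_apply_mono (hg0 i) h1
    rw [map_add, map_smul, smul_eq_mul] at h2
    have h3 : s⁻¹ * g i u ≤ s⁻¹ * C := mul_le_mul_of_nonneg_left (hC i) (by positivity)
    linarith [hv i hiI]
  · exact fun j hj => hj.1.1
  · rintro j ⟨⟨-, hj⟩, hij⟩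
    refine ⟨not_le.1 hij, ?_⟩
    have h1 : u - (u - s • v i)⁺ ≤ s • v i := sub_le_comm.1 (le_posPart _)
    have h2 := dual_apply_mono (hg0 j) h1
    rw [map_smul, smul_eq_mul] at h2
    rw [← div_eq_inv_mul, le_div_iff₀ hs0] at hj
    linarith

/-- Disjoint positive functionals that are bounded at `u` are, along a subsequence, almost carried
by disjoint elements of the order interval `[0, u]`. -/
theorem exists_disjoint_carriers {g : ℕ → StrongDual ℝ E} (hg0 : ∀ n, 0 ≤ g n)
    (hd : Pairwise fun i j => g i ⊓ g j = 0) {u : E} (hu : 0 ≤ u) {C : ℝ} (hC : ∀ n, g n u ≤ C)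
    {η : ℝ} (hη : 0 < η) :
    ∃ n : ℕ → ℕ, StrictMono n ∧ ∃ w : ℕ → E, (∀ k, 0 ≤ w k) ∧ (∀ k, w k ≤ u) ∧
      (Pairwise fun i j => w i ⊓ w j = 0) ∧ ∀ k, g (n k) (u - w k) ≤ η := by
  -- a state: the indices still available, the part of `u` still available, and a bound for the
  -- mass which the available functionals have lost
  let Inv : Set ℕ × E × ℝ → Prop := fun t =>
    t.1.Infinite ∧ 0 ≤ t.2.1 ∧ t.2.1 ≤ u ∧ t.2.2 < η ∧ ∀ j ∈ t.1, g j (u - t.2.1) ≤ t.2.2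
  have step : ∀ t : {t // Inv t}, ∃ t' : {t // Inv t}, ∃ i : ℕ, ∃ w : E,
      t'.1.1 ⊆ t.1.1 ∧ i ∈ t.1.1 ∧ (∀ j ∈ t'.1.1, i < j) ∧ t'.1.2.1 ≤ t.1.2.1 ∧ 0 ≤ w ∧
        w ≤ t.1.2.1 ∧ w ⊓ t'.1.2.1 = 0 ∧ g i (u - w) ≤ η := by
    rintro ⟨⟨S, v, b⟩, hS, hv0, hvu, hb, hSb⟩
    dsimp only at hS hv0 hvu hb hSb ⊢
    obtain ⟨i, hi, w, v', hw0, hwv, hv'0, hv'v, hwv', hgi, S', hS'S, hS', hS'g⟩ :=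
      exists_extraction_step hg0 hd hv0 (fun n => (dual_apply_mono (hg0 n) hvu).trans (hC n)) hS
        (δ := (η - b) / 2) (by linarith)
    refine ⟨⟨⟨S', v', (η + b) / 2⟩, hS', hv'0, hv'v.trans hvu, ?_, fun j hj => ?_⟩, i, w, hS'S, hi,
      fun j hj => (hS'g j hj).1, hv'v, hw0, hwv, hwv', ?_⟩
    · dsimp only; linarith
    · dsimp only
      rw [← sub_add_sub_cancel u v v', map_add]
      linarith [hSb j (hS'S hj), (hS'g j hj).2]
    · rw [← sub_add_sub_cancel u v w, map_add]
      linarith [hSb i hi]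
  choose next i w h1 h2 h3 h4 h5 h6 h7 h8 using step
  let t₀ : {t // Inv t} := ⟨⟨Set.univ, u, 0⟩, Set.infinite_univ, hu, le_rfl, hη, fun j _ => by simp⟩
  let st : ℕ → {t // Inv t} := fun k => next^[k] t₀
  have hst : ∀ k, st (k + 1) = next (st k) := fun k => Function.iterate_succ_apply' _ _ _
  have hanti : Antitone fun k => (st k).1.2.1 := antitone_nat_of_succ_le fun k => by
    simp only [hst]; exact h4 _
  have hlt : ∀ k l, k < l → w (st k) ⊓ w (st l) = 0 := fun k l hkl =>
    inf_eq_zero_of_le (h5 _) (h5 _) le_rfl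
      ((h6 (st l)).trans ((hanti (Nat.succ_le_of_lt hkl)).trans
        (le_of_eq (by simp only [Nat.succ_eq_add_one, hst])))) (h7 (st k))
  refine ⟨fun k => i (st k), strictMono_nat_of_lt_succ fun k => h3 (st k) _ ?_, fun k => w (st k),
    fun k => h5 _, fun k => (h6 _).trans (st k).2.2.2.1, fun k l hkl => ?_, fun k => h8 _⟩
  · rw [← hst]; exact h2 _
  · rcases hkl.lt_or_gt with h | h
    · exact hlt k l h
    · rw [inf_comm]; exact hlt l k h

end Extraction

/-! ### Disjoint weak* null sequences -/

section WeakStar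

variable {F : Type*} [NormedAddCommGroup F] [NormedSpace ℝ F] [Lattice F]
  [IsOrderedAddMonoid F] [IsOrderedModule ℝ F] [HasSolidNorm F]

/-- In a `σ`-Dedekind complete Banach lattice the moduli of a disjoint weak* null sequence are weak*
null. Otherwise there are disjoint elements `y k` of an order interval, almost carrying `f k` and
on which `f k` is large; then `f k` is large on `⨆ k, y k` as well. -/
theorem tendsto_abs_dual_apply [CompleteSpace F] (hF : SigmaDedekindComplete F)
    {f : ℕ → StrongDual ℝ F} (hd : DualDisjointSeq f) (hf : WeakStarNull f) {u : F} (hu : 0 ≤ u) :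
    Tendsto (fun n => |f n| u) atTop (𝓝 0) := by
  by_contra hcon
  obtain ⟨ε, hε, n, hn, hfu⟩ := exists_subseq_of_not_tendsto_zero
    (fun n => dual_apply_nonneg (abs_nonneg (f n)) hu) hcon
  obtain ⟨C, hC⟩ := hf.exists_norm_le
  obtain ⟨m, hm, w, hw0, hwu, hwd, hw⟩ := exists_disjoint_carriers (g := fun k => |f (n k)|)
    (fun k => abs_nonneg _)
    (fun i j hij => (dualDisjoint_iff _ _).1 (hd (hn.injective.ne hij))) hu
    (C := 4 * (C * ‖u‖))
    (fun k => (abs_dual_apply_le_norm _ hu).trans (by gcongr; exact hC _))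
    (η := ε / 16) (by positivity)
  set h : ℕ → StrongDual ℝ F := fun k => f (n (m k)) with hh
  have hnull : WeakStarNull h := hf.comp (hn.comp hm)
  choose y hy0 hyw hy using fun k =>
    exists_dual_abs_lt (h k) (hw0 k) (show 0 < ε / 4 by positivity)
  obtain ⟨a, ha⟩ := hF (Set.range y) (Set.countable_range y) (Set.range_nonempty y)
    ⟨u, by rintro _ ⟨k, rfl⟩; exact (hyw k).trans (hwu k)⟩
  have hay : ∀ k, a ≤ y k + (u - w k) := by
    intro k
    refine ha.2 ?_
    rintro _ ⟨j, rfl⟩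
    by_cases hjk : j = k
    · subst hjk
      exact le_add_of_nonneg_right (sub_nonneg.2 (hwu j))
    · refine (hyw j).trans (le_trans ?_ (le_add_of_nonneg_left (hy0 k)))
      exact le_sub_iff_add_le.2 (add_le_of_inf_eq_zero (hwd hjk) (hwu j) (hwu k))
  obtain ⟨k, hk⟩ := ((hnull a).abs.eventually
    (gt_mem_nhds (show |(0 : ℝ)| < ε / 16 by rw [abs_zero]; positivity))).exists
  have hya : y k ≤ a := ha.1 ⟨k, rfl⟩
  have e1 : |h k (a - y k)| ≤ ε / 16 := by
    refine (abs_dual_apply_le _ _).trans (le_trans ?_ (hw k))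
    rw [abs_of_nonneg (sub_nonneg.2 hya)]
    exact dual_apply_mono (abs_nonneg _) (sub_le_iff_le_add'.2 (hay k))
  have e2 : |h k (y k)| ≤ |h k a| + |h k (a - y k)| := by
    rw [show h k (y k) = h k a - h k (a - y k) by rw [map_sub, sub_sub_cancel]]
    exact abs_sub _ _
  have e3 := hw k
  rw [map_sub] at e3
  linarith [hy k, hfu (m k)]

/-- Disjoint order bounded sequences are norm null if the norm is order continuous. -/
theorem tendsto_norm_of_disjoint_of_le {F : Type*} [NormedAddCommGroup F] [Lattice F]
    [IsOrderedAddMonoid F] [HasSolidNorm F] (hF : SigmaDedekindComplete F)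
    (hoc : OrderContinuousNorm F) {w : ℕ → F} {u : F} (hw0 : ∀ n, 0 ≤ w n) (hwu : ∀ n, w n ≤ u)
    (hd : Pairwise fun i j => w i ⊓ w j = 0) : Tendsto (fun n => ‖w n‖) atTop (𝓝 0) := by
  set s : ℕ → F := fun n => ∑ i ∈ Finset.range n, w i with hs
  have hmono : Monotone s := monotone_nat_of_le_succ fun n => by
    simp only [hs, Finset.sum_range_succ]
    exact le_add_of_nonneg_right (hw0 n)
  obtain ⟨a, ha⟩ := hF (Set.range s) (Set.countable_range s) (Set.range_nonempty s)
    ⟨u, by rintro _ ⟨n, rfl⟩; exact sum_le_of_disjoint hw0 hwu hd _⟩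
  have hsa : ∀ n, s n ≤ a := fun n => ha.1 ⟨n, rfl⟩
  have hoc' := hoc (Set.range fun n => a - s n) (Set.range_nonempty _)
    (by
      rintro _ ⟨i, rfl⟩ _ ⟨j, rfl⟩
      exact ⟨_, ⟨max i j, rfl⟩, sub_le_sub_left (hmono (le_max_left i j)) a,
        sub_le_sub_left (hmono (le_max_right i j)) a⟩)
    ⟨by rintro _ ⟨i, rfl⟩; exact sub_nonneg.2 (hsa i), fun b hb => by
      have : a ≤ a - b := ha.2 (by
        rintro _ ⟨i, rfl⟩
        exact le_sub_comm.1 (hb ⟨i, rfl⟩))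
      simpa using this⟩
  rw [Metric.tendsto_atTop]
  intro ε hε
  obtain ⟨_, ⟨N, rfl⟩, hN⟩ := hoc' ε hε
  refine ⟨N, fun n hn => ?_⟩
  rw [Real.dist_eq, sub_zero, abs_norm]
  refine lt_of_le_of_lt (norm_le_norm_of_nonneg_of_le (hw0 n) ?_)
    (hN _ ⟨n, rfl⟩ (sub_le_sub_left (hmono hn) a))
  have := hsa (n + 1)
  simp only [hs, Finset.sum_range_succ] at this
  exact le_sub_iff_add_le'.2 this

/-- If the norm is order continuous, then norm bounded disjoint sequences of positive functionals
are weak* null. -/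
theorem weakStarNull_of_disjoint (hF : SigmaDedekindComplete F) (hoc : OrderContinuousNorm F)
    {g : ℕ → StrongDual ℝ F} (hg0 : ∀ n, 0 ≤ g n) {C : ℝ} (hC : ∀ n x, 0 ≤ x → g n x ≤ C * ‖x‖)
    (hd : Pairwise fun i j => g i ⊓ g j = 0) : WeakStarNull g := by
  have hpos : ∀ x, 0 ≤ x → Tendsto (fun n => g n x) atTop (𝓝 0) := by
    intro x hx
    by_contra hcon
    obtain ⟨ε, hε, n, hn, hgx⟩ := exists_subseq_of_not_tendsto_zero
      (fun n => dual_apply_nonneg (hg0 n) hx) hcon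
    obtain ⟨m, hm, w, hw0, hwx, hwd, hw⟩ := exists_disjoint_carriers (g := fun k => g (n k))
      (fun k => hg0 _) (fun i j hij => hd (hn.injective.ne hij)) hx (fun k => hC _ x hx)
      (half_pos hε)
    have hlim := (tendsto_norm_of_disjoint_of_le hF hoc hw0 hwx hwd).const_mul C
    rw [mul_zero] at hlim
    obtain ⟨k, hk⟩ := (hlim.eventually (gt_mem_nhds (half_pos hε))).exists
    have h1 := hw k
    rw [map_sub] at h1
    linarith [hgx (m k), hC (n (m k)) (w k) (hw0 k)]
  intro x
  have := (hpos x⁺ (posPart_nonneg x)).sub (hpos x⁻ (negPart_nonneg x))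
  rw [sub_zero] at this
  refine this.congr fun n => ?_
  rw [← map_sub, posPart_sub_negPart]

end WeakStar

/-! ### Failure of order continuity and of the positive Schur property -/

section NotOrderContinuous

variable {F : Type*} [NormedAddCommGroup F] [CompleteSpace F] [Lattice F]
  [IsOrderedAddMonoid F] [HasSolidNorm F]

/-- If every downward directed net of positive elements is a Cauchy net, then the norm is order
continuous. -/
theorem orderContinuousNorm_of_cauchy
    (h : ∀ s : Set F, s.Nonempty → DirectedOn (fun x y => y ≤ x) s → (∀ x ∈ s, 0 ≤ x) →
      ∀ δ : ℝ, 0 < δ → ∃ x ∈ s, ∀ y ∈ s, y ≤ x → ‖x - y‖ < δ) : OrderContinuousNorm F := by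
  intro s hne hdir hglb ε hε
  have h0 : ∀ x ∈ s, 0 ≤ x := fun x hx => hglb.1 hx
  -- the limit of a Cauchy sequence picked from the net is a lower bound of the net, hence zero
  choose x hxs hx using fun k : ℕ => h s hne hdir h0 (1 / ((k : ℝ) + 1)) (by positivity)
  have hcauchy : CauchySeq x := by
    refine cauchySeq_of_le_tendsto_0 (fun N : ℕ => 1 / ((N : ℝ) + 1) + 1 / ((N : ℝ) + 1))
      (fun n m N hn hm => ?_) ?_
    · obtain ⟨z, hzs, hzn, hzm⟩ := hdir _ (hxs n) _ (hxs m)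
      have h1 := hx n z hzs hzn
      have h2 := hx m z hzs hzm
      have h3 : 1 / ((n : ℝ) + 1) ≤ 1 / ((N : ℝ) + 1) := Nat.one_div_le_one_div hn
      have h4 : 1 / ((m : ℝ) + 1) ≤ 1 / ((N : ℝ) + 1) := Nat.one_div_le_one_div hm
      have h5 := dist_triangle_right (x n) (x m) z
      rw [dist_eq_norm (x n) z, dist_eq_norm (x m) z] at h5
      linarith
    · simpa using tendsto_one_div_add_atTop_nhds_zero_nat.add
        (tendsto_one_div_add_atTop_nhds_zero_nat (𝕜 := ℝ))
  obtain ⟨a, ha⟩ := cauchySeq_tendsto_of_complete hcauchy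
  have ha0 : a = 0 := by
    refine le_antisymm (hglb.2 fun y hy => ?_) (ge_of_tendsto' ha fun k => h0 _ (hxs k))
    choose z hzs hzx hzy using fun k => hdir _ (hxs k) _ hy
    refine le_of_tendsto' (f := z) (x := atTop) ?_ hzy
    have hz : Tendsto (fun k => x k - z k) atTop (𝓝 0) :=
      squeeze_zero_norm (fun k => (hx k _ (hzs k) (hzx k)).le)
        tendsto_one_div_add_atTop_nhds_zero_nat
    simpa using ha.sub hz
  subst ha0
  obtain ⟨k, hk⟩ := (ha.norm.eventually (gt_mem_nhds (show ‖(0 : F)‖ < ε by simpa))).exists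
  exact ⟨x k, hxs k, fun y hy hyx => (norm_le_norm_of_nonneg_of_le (h0 y hy) hyx).trans_lt hk⟩

/-- If the norm is not order continuous, then some order interval contains a series of positive
elements whose terms do not tend to zero. -/
theorem exists_order_bounded_series (h : ¬ OrderContinuousNorm F) :
    ∃ u : F, 0 ≤ u ∧ ∃ v : ℕ → F, (∀ n, 0 ≤ v n) ∧ (∀ n, ∑ i ∈ Finset.range n, v i ≤ u) ∧
      ∃ δ : ℝ, 0 < δ ∧ ∀ n, δ ≤ ‖v n‖ := by
  have h' := mt orderContinuousNorm_of_cauchy h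
  push Not at h'
  obtain ⟨s, ⟨x₀, hx₀⟩, -, h0, δ, hδ, hs⟩ := h'
  choose next hnext hle hδn using hs
  let f : s → s := fun x => ⟨next x x.2, hnext x x.2⟩
  let st : ℕ → s := fun k => f^[k] ⟨x₀, hx₀⟩
  have hst : ∀ k, st (k + 1) = f (st k) := fun k => Function.iterate_succ_apply' _ _ _
  refine ⟨x₀, h0 x₀ hx₀, fun k => st k - st (k + 1), fun k => ?_, fun k => ?_, δ, hδ, fun k => ?_⟩
  · simp only [hst]; exact sub_nonneg.2 (hle _ _)
  · rw [Finset.sum_range_sub' (fun k => (st k : F))]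
    exact sub_le_self _ (h0 _ (st k).2)
  · simp only [hst]; exact hδn _ _

end NotOrderContinuous

section NotSchur

variable {E : Type*} [NormedAddCommGroup E] [NormedSpace ℝ E] [Lattice E]
  [IsOrderedAddMonoid E] [IsOrderedModule ℝ E] [HasSolidNorm E]

theorem dual_apply_le_norm {E : Type*} [NormedAddCommGroup E] [NormedSpace ℝ E]
    {φ : StrongDual ℝ E} (hφ : ‖φ‖ ≤ 1) (x : E) : φ x ≤ ‖x‖ :=
  (le_abs_self _).trans ((φ.le_opNorm x).trans (mul_le_of_le_one_left (norm_nonneg x) hφ))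

/-- An order bounded weakly null sequence of positive elements with norms bounded below dominates,
termwise along a subsequence, a disjoint one: make norming functionals disjoint and cut the elements
down to disjoint pieces of the order interval that carry these functionals. -/
theorem exists_disjoint_weaklyNull_of_le {x : ℕ → E} (hx0 : ∀ n, 0 ≤ x n) (hx : WeaklyNull x)
    {u : E} (hxu : ∀ n, x n ≤ u) {ε : ℝ} (hε : 0 < ε) (hxε : ∀ n, ε ≤ ‖x n‖) :
    ∃ z : ℕ → E, (∀ n, 0 ≤ z n) ∧ (Pairwise fun i j => z i ⊓ z j = 0) ∧ WeaklyNull z ∧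
      ∃ δ : ℝ, 0 < δ ∧ ∀ n, δ ≤ ‖z n‖ := by
  choose φ hφ0 hφ1 hφ using fun n => exists_positive_functional_norm_posPart (x n)
  obtain ⟨n, hn, g, hg0, hgφ, hgd, hg⟩ := exists_disjoint_functionals (y := x)
    (by simpa only [abs_of_nonneg (hx0 _)] using hx) hφ0 hφ1 hε
    (fun n => by rw [hφ n, posPart_of_nonneg (hx0 n)]; exact hxε n)
  have hgn : ∀ k y, 0 ≤ y → g k y ≤ ‖y‖ := fun k y hy =>
    (hgφ k y hy).trans (dual_apply_le_norm (hφ1 _) y)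
  have hu : 0 ≤ u := (hx0 0).trans (hxu 0)
  obtain ⟨m, hm, w, hw0, hwu, hwd, hw⟩ := exists_disjoint_carriers hg0 hgd hu
    (fun k => hgn k u hu) (show 0 < ε / 4 by positivity)
  have hz0 : ∀ k, 0 ≤ w k ⊓ x (n (m k)) := fun k => le_inf (hw0 k) (hx0 _)
  refine ⟨fun k => w k ⊓ x (n (m k)), hz0,
    fun i j hij => inf_eq_zero_of_le (hz0 i) (hz0 j) inf_le_left inf_le_left (hwd hij),
    (hx.comp (hn.comp hm)).of_nonneg_of_le hz0 fun k => inf_le_right, ε / 4, by positivity,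
    fun k => ?_⟩
  refine le_trans ?_ (hgn (m k) _ (hz0 k))
  have h1 : x (n (m k)) - w k ⊓ x (n (m k)) ≤ u - w k := by
    rw [sub_inf, sub_self]
    exact sup_le (sub_le_sub_right (hxu _) _) (sub_nonneg.2 (hwu k))
  have h2 := dual_apply_mono (hg0 (m k)) h1
  rw [map_sub] at h2
  linarith [hw k, hg (m k)]

/-- The positive Schur property need only be tested on disjoint sequences. Either the elements
`x n` are not almost contained in one order interval, and suitable differences are disjoint, or the
problem reduces to order bounded sequences. -/
theorem exists_disjoint_weaklyNull [CompleteSpace E] (h : ¬ PositiveSchur E) :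
    ∃ z : ℕ → E, (∀ n, 0 ≤ z n) ∧ (Pairwise fun i j => z i ⊓ z j = 0) ∧ WeaklyNull z ∧
      ∃ δ : ℝ, 0 < δ ∧ ∀ n, δ ≤ ‖z n‖ := by
  unfold PositiveSchur at h
  push Not at h
  obtain ⟨x', hx'0, hx', hlim⟩ := h
  obtain ⟨ε, hε, n', hn', hxε⟩ := exists_subseq_of_not_tendsto_zero (fun _ => norm_nonneg _) hlim
  obtain ⟨x, hx0, hx, hxε⟩ : ∃ x : ℕ → E, (∀ n, 0 ≤ x n) ∧ WeaklyNull x ∧ ∀ n, ε ≤ ‖x n‖ :=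
    ⟨fun k => x' (n' k), fun k => hx'0 _, hx'.comp hn', hxε⟩
  -- if this holds, the remainders after removing multiples of earlier terms stay large, and if it
  -- fails for `m`, then `x n ⊓ u` stays large for a fixed `u`
  by_cases hA : ∀ m, ∃ n, m < n ∧
      ε / 2 ≤ ‖(x n - (4 : ℝ) ^ (m + 1) • ∑ i ∈ Finset.range (m + 1), x i)⁺‖
  · obtain ⟨n, hn, hP⟩ := exists_strictMono_chain hA
    obtain ⟨C, hC⟩ := hx.exists_norm_le
    have hsum : Summable fun i => (2⁻¹ : ℝ) ^ i • x (n i) := by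
      refine Summable.of_norm_bounded (g := fun i => (2⁻¹ : ℝ) ^ i * C)
        ((summable_geometric_of_lt_one (by norm_num) (by norm_num)).mul_right C) fun i => ?_
      rw [norm_smul, Real.norm_of_nonneg (by positivity)]
      exact mul_le_mul_of_nonneg_left (hC _) (by positivity)
    set X : E := ∑' i, (2⁻¹ : ℝ) ^ i • x (n i) with hX
    have hXle : ∀ i, (2⁻¹ : ℝ) ^ i • x (n i) ≤ X := fun i =>
      hsum.le_tsum i fun j _ => smul_nonneg (by positivity) (hx0 _)
    have hX0 : 0 ≤ X := (smul_nonneg (by positivity) (hx0 (n 0))).trans (hXle 0)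
    have hd := pairwise_disjoint_posPart_sub (x := fun i => x (n i)) (fun i => hx0 _) hXle
    have hlim : Tendsto (fun k : ℕ => (2⁻¹ : ℝ) ^ k * ‖X‖) atTop (𝓝 0) := by
      simpa using (tendsto_pow_atTop_nhds_zero_of_lt_one (r := (2⁻¹ : ℝ)) (by norm_num)
        (by norm_num)).mul_const ‖X‖
    obtain ⟨K, hK⟩ := eventually_atTop.1 (hlim.eventually
      (gt_mem_nhds (show 0 < ε / 4 by positivity)))
    have hshift : StrictMono fun k => k + K + 1 := fun a b hab => by simpa using hab
    refine ⟨_, fun k => posPart_nonneg _, fun i j hij => hd (hshift.injective.ne hij),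
      (hx.comp (hn.comp hshift)).of_nonneg_of_le (fun k => posPart_nonneg _) fun k => ?_, ε / 4,
      by positivity, fun k => ?_⟩
    · refine sup_le ?_ (hx0 _)
      rw [sub_sub]
      exact sub_le_self _ (add_nonneg
        (smul_nonneg (by positivity) (Finset.sum_nonneg fun i _ => hx0 _))
        (smul_nonneg (by positivity) hX0))
    · set l := k + K + 1 with hl
      set a := x (n l) - (4 : ℝ) ^ l • ∑ i ∈ Finset.range l, x (n i) with ha
      have hb0 : 0 ≤ (2⁻¹ : ℝ) ^ l • X := smul_nonneg (by positivity) hX0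
      have h1 : ε / 2 ≤ ‖a⁺‖ := (hP (k + K)).trans (norm_le_norm_of_nonneg_of_le
        (posPart_nonneg _) (posPart_mono (sub_le_sub_left
          (pow_smul_sum_subseq_le hx0 hn (k + K)) _)))
      have h2 : a⁺ ≤ (a - (2⁻¹ : ℝ) ^ l • X)⁺ + (2⁻¹ : ℝ) ^ l • X :=
        sup_le (sub_le_iff_le_add.1 (le_posPart _)) (add_nonneg (posPart_nonneg _) hb0)
      have h3 := (norm_le_norm_of_nonneg_of_le (posPart_nonneg a) h2).trans (norm_add_le _ _)
      rw [norm_smul, Real.norm_of_nonneg (by positivity)] at h3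
      linarith [hK l (by omega)]
  · push Not at hA
    obtain ⟨m, hm⟩ := hA
    set u := (4 : ℝ) ^ (m + 1) • ∑ i ∈ Finset.range (m + 1), x i with hu
    have hu0 : 0 ≤ u := smul_nonneg (by positivity) (Finset.sum_nonneg fun i _ => hx0 i)
    have hshift : StrictMono fun k => k + m + 1 := fun a b hab => by simpa using hab
    refine exists_disjoint_weaklyNull_of_le (x := fun k => x (k + m + 1) ⊓ u) (u := u)
      (fun k => le_inf (hx0 _) hu0)
      ((hx.comp hshift).of_nonneg_of_le (fun k => le_inf (hx0 _) hu0) fun k => inf_le_left)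
      (fun k => inf_le_right) (half_pos hε) fun k => ?_
    have h1 : x (k + m + 1) = x (k + m + 1) ⊓ u + (x (k + m + 1) - u)⁺ := by
      rw [inf_eq_sub_posPart_sub, sub_add_cancel]
    have h2 := norm_add_le (x (k + m + 1) ⊓ u) (x (k + m + 1) - u)⁺
    rw [← h1] at h2
    linarith [hm (k + m + 1) (by omega), hxε (k + m + 1)]

end NotSchur

/-! ### Weak almost limited operators -/

section Operators

variable {E : Type*} [NormedAddCommGroup E] [NormedSpace ℝ E] [Lattice E]
  [IsOrderedAddMonoid E] [HasSolidNorm E]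
variable {F : Type*} [NormedAddCommGroup F] [NormedSpace ℝ F] [Lattice F]
  [IsOrderedAddMonoid F] [IsOrderedModule ℝ F] [HasSolidNorm F]

/-- The operator `x ↦ ∑ f n (x) v n`, where the sum is the supremum of the partial sums. -/
theorem exists_order_sum_operator (hF : SigmaDedekindComplete F) {f : ℕ → StrongDual ℝ E}
    (hf0 : ∀ n, 0 ≤ f n) (hf1 : ∀ n x, f n x ≤ ‖x‖) {u : F} {v : ℕ → F} (hv0 : ∀ n, 0 ≤ v n)
    (hvu : ∀ n, ∑ i ∈ Finset.range n, v i ≤ u) :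
    ∃ T : E →L[ℝ] F, PositiveOp T ∧ (∀ x, 0 ≤ x → T x ≤ ‖x‖ • u) ∧
      ∀ n x, 0 ≤ x → f n x • v n ≤ T x := by
  set s : E → ℕ → F := fun x m => ∑ i ∈ Finset.range m, f i x • v i with hs
  have hterm : ∀ x, 0 ≤ x → ∀ i, 0 ≤ f i x • v i := fun x hx i =>
    smul_nonneg (dual_apply_nonneg (hf0 i) hx) (hv0 i)
  have hmono : ∀ x, 0 ≤ x → Monotone (s x) := fun x hx => monotone_nat_of_le_succ fun m => by
    simp only [hs, Finset.sum_range_succ]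
    exact le_add_of_nonneg_right (hterm x hx m)
  have hsu : ∀ x, 0 ≤ x → ∀ m, s x m ≤ ‖x‖ • u := fun x hx m => by
    refine le_trans ?_ (smul_le_smul_of_nonneg_left (hvu m) (norm_nonneg x))
    rw [Finset.smul_sum]
    exact Finset.sum_le_sum fun i _ => smul_le_smul_of_nonneg_right (hf1 i x) (hv0 i)
  have hex : ∀ x, ∃ a, 0 ≤ x → IsLUB (Set.range (s x)) a := fun x => by
    by_cases hx : 0 ≤ x
    · obtain ⟨a, ha⟩ := hF (Set.range (s x)) (Set.countable_range _) (Set.range_nonempty _)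
        ⟨‖x‖ • u, by rintro _ ⟨m, rfl⟩; exact hsu x hx m⟩
      exact ⟨a, fun _ => ha⟩
    · exact ⟨0, fun h => absurd h hx⟩
  choose p hp using hex
  have hsp : ∀ x, 0 ≤ x → ∀ m, s x m ≤ p x := fun x hx m => (hp x hx).1 ⟨m, rfl⟩
  have hpu : ∀ x, 0 ≤ x → p x ≤ ‖x‖ • u := fun x hx =>
    (hp x hx).2 (by rintro _ ⟨m, rfl⟩; exact hsu x hx m)
  have hp0 : ∀ x, 0 ≤ x → 0 ≤ p x := fun x hx => by simpa [hs] using hsp x hx 0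
  obtain ⟨T, hT⟩ := exists_clm_of_additive_on_cone p ‖u‖
    (fun x y hx hy => by
      have hadd : ∀ m, s (x + y) m = s x m + s y m := fun m => by
        simp only [hs, map_add, add_smul, Finset.sum_add_distrib]
      refine (hp _ (add_nonneg hx hy)).unique ⟨?_, fun b hb => ?_⟩
      · rintro _ ⟨m, rfl⟩
        rw [hadd]
        exact add_le_add (hsp x hx m) (hsp y hy m)
      · have h1 : ∀ k l, s x k + s y l ≤ b := fun k l => by
          refine le_trans (add_le_add (hmono x hx (le_max_left k l))
            (hmono y hy (le_max_right k l))) ?_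
          rw [← hadd]
          exact hb ⟨_, rfl⟩
        have h2 : ∀ k, s x k + p y ≤ b := fun k => by
          rw [← le_sub_iff_add_le']
          refine (hp y hy).2 ?_
          rintro _ ⟨l, rfl⟩
          exact le_sub_iff_add_le'.2 (h1 k l)
        rw [← le_sub_iff_add_le]
        refine (hp x hx).2 ?_
        rintro _ ⟨k, rfl⟩
        exact le_sub_iff_add_le.2 (h2 k))
    (fun x hx => by
      refine (norm_le_norm_of_nonneg_of_le (hp0 x hx) (hpu x hx)).trans (le_of_eq ?_)
      rw [norm_smul, norm_norm, mul_comm])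
  refine ⟨T, fun x hx => by rw [hT x hx]; exact hp0 x hx, fun x hx => by
    rw [hT x hx]; exact hpu x hx, fun n x hx => ?_⟩
  rw [hT x hx]
  refine le_trans ?_ (hsp x hx (n + 1))
  exact Finset.single_le_sum (f := fun i => f i x • v i) (fun i _ => hterm x hx i)
    (Finset.self_mem_range_succ n)

/-- An operator that maps the unit ball into an order interval of a `σ`-Dedekind complete Banach
lattice is weak almost limited, because order intervals are almost limited sets. -/
theorem weakAlmostLimited_of_abs_le [CompleteSpace F] {X : Type*} [NormedAddCommGroup X]
    [NormedSpace ℝ X] (hF : SigmaDedekindComplete F) {T : X →L[ℝ] F} {u : F} (hu : 0 ≤ u)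
    (hT : ∀ x, |T x| ≤ ‖x‖ • u) : WeakAlmostLimited T := by
  intro W hW
  obtain ⟨C, hC⟩ := hW.exists_norm_le
  refine ⟨isBounded_iff_forall_norm_le.2 ⟨‖T‖ * C, ?_⟩, fun f hfd hf => ?_⟩
  · rintro _ ⟨x, hx, rfl⟩
    exact (T.le_opNorm x).trans (mul_le_mul_of_nonneg_left (hC x hx) (norm_nonneg T))
  · rw [Metric.tendstoUniformlyOn_iff]
    intro ε hε
    have hlim := (tendsto_abs_dual_apply hF hfd hf hu).const_mul C
    rw [mul_zero] at hlim
    filter_upwards [hlim.eventually (gt_mem_nhds hε)] with n hn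
    rintro _ ⟨x, hx, rfl⟩
    rw [dist_zero_left, Real.norm_eq_abs]
    refine lt_of_le_of_lt ((abs_dual_apply_le _ _).trans ?_) hn
    refine (dual_apply_mono (abs_nonneg (f n)) (hT x)).trans ?_
    rw [map_smul, smul_eq_mul]
    exact mul_le_mul_of_nonneg_right (hC x hx) (dual_apply_nonneg (abs_nonneg _) hu)

theorem PositiveOp.orderBoundedOp {E F : Type*} [NormedAddCommGroup E] [NormedSpace ℝ E]
    [Lattice E] [IsOrderedAddMonoid E] [NormedAddCommGroup F] [NormedSpace ℝ F] [Lattice F]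
    [IsOrderedAddMonoid F] {T : E →L[ℝ] F} (hT : PositiveOp T) : OrderBoundedOp T := by
  have hmono : ∀ x y, x ≤ y → T x ≤ T y := fun x y h => by
    have := hT (y - x) (sub_nonneg.2 h)
    rwa [map_sub, sub_nonneg] at this
  rintro a b
  refine ⟨T a, T b, ?_⟩
  rintro _ ⟨x, hx, rfl⟩
  exact ⟨hmono _ _ hx.1, hmono _ _ hx.2⟩

variable [CompleteSpace E] [IsOrderedModule ℝ E]

/-- A disjoint weakly null sequence has weakly null moduli, so the positive Schur property makes it
norm null. -/
theorem PositiveSchur.almostDunfordPettis {X : Type*} [NormedAddCommGroup X] [NormedSpace ℝ X]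
    (h : PositiveSchur E) (T : E →L[ℝ] X) : AlmostDunfordPettis T := by
  intro x hd hx
  have h1 := h _ (fun n => abs_nonneg (x n)) (hd.weaklyNull_abs hx)
  simp only [norm_abs_eq_norm] at h1
  have h2 := h1.const_mul ‖T‖
  rw [mul_zero] at h2
  exact squeeze_zero (fun n => norm_nonneg _) (fun n => T.le_opNorm _) h2

/-- If the positive parts of `T (x n)` stayed large, functionals norming them could be made
disjoint, because the moduli of `T (x n)` are weakly null. Such functionals are weak* null by order
continuity, which contradicts that `T` maps `{x n}` to an almost limited set. -/
theorem OrderContinuousNorm.tendsto_norm_posPart (hF : SigmaDedekindComplete F)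
    (hoc : OrderContinuousNorm F) {T : E →L[ℝ] F} (hT : OrderBoundedOp T)
    (hTw : WeakAlmostLimited T) {x : ℕ → E} (hd : DisjointSeq x) (hx : WeaklyNull x) :
    Tendsto (fun n => ‖(T (x n))⁺‖) atTop (𝓝 0) := by
  by_contra hcon
  obtain ⟨ε, hε, m, hm, hxε⟩ := exists_subseq_of_not_tendsto_zero (fun _ => norm_nonneg _) hcon
  choose φ hφ0 hφ1 hφ using fun k => exists_positive_functional_norm_posPart (T (x (m k)))
  obtain ⟨n, hn, g, hg0, hgφ, hgd, hg⟩ := exists_disjoint_functionals (y := fun k => T (x (m k)))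
    ((hT.weaklyNull_abs hd hx).comp hm) hφ0 hφ1 hε (fun k => by rw [hφ k]; exact hxε k)
  have hnull : WeakStarNull g := weakStarNull_of_disjoint hF hoc hg0 (C := 1)
    (fun k y hy => by
      rw [one_mul]
      exact (hgφ k y hy).trans (dual_apply_le_norm (hφ1 _) y)) hgd
  have hgd' : DualDisjointSeq g := fun i j hij => by
    refine (dualDisjoint_iff _ _).2 ?_
    rw [abs_of_nonneg (hg0 i), abs_of_nonneg (hg0 j)]
    exact hgd hij
  have hunif := (hTw _ hx.relWeaklyCompact_range).2 g hgd' hnull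
  rw [Metric.tendstoUniformlyOn_iff] at hunif
  obtain ⟨k, hk⟩ := (hunif (ε / 2) (half_pos hε)).exists
  have h1 := hk (T (x (m (n k)))) ⟨_, ⟨_, rfl⟩, rfl⟩
  rw [dist_zero_left, Real.norm_eq_abs] at h1
  linarith [hg k, le_abs_self (g k (T (x (m (n k)))))]

theorem OrderContinuousNorm.almostDunfordPettis (hF : SigmaDedekindComplete F)
    (hoc : OrderContinuousNorm F) {T : E →L[ℝ] F} (hT : OrderBoundedOp T)
    (hTw : WeakAlmostLimited T) : AlmostDunfordPettis T := by
  intro x hd hx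
  have h1 := hoc.tendsto_norm_posPart hF hT hTw hd hx
  have h2 := hoc.tendsto_norm_posPart hF hT hTw (x := fun n => -x n)
    (fun i j hij => by simpa only [abs_neg] using hd hij)
    (fun f => by simpa using (hx f).neg)
  have h3 := h1.add h2
  rw [add_zero] at h3
  refine squeeze_zero (fun n => norm_nonneg _) (fun n => ?_) h3
  rw [map_neg, posPart_neg]
  nth_rw 1 [← posPart_sub_negPart (T (x n))]
  exact norm_sub_le _ _

/-- If `E` fails the positive Schur property and the norm of `F` is not order continuous, then
some positive weak almost limited operator is not almost Dunford–Pettis. -/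
theorem exists_positive_weakAlmostLimited_not_almostDunfordPettis [CompleteSpace F]
    (hF : SigmaDedekindComplete F) (hE : ¬ PositiveSchur E) (hoc : ¬ OrderContinuousNorm F) :
    ∃ T : E →L[ℝ] F, PositiveOp T ∧ WeakAlmostLimited T ∧ ¬ AlmostDunfordPettis T := by
  obtain ⟨u, hu, v, hv0, hvu, δ, hδ, hvδ⟩ := exists_order_bounded_series hoc
  obtain ⟨z, hz0, hzd, hz, ε, hε, hzε⟩ := exists_disjoint_weaklyNull hE
  choose f hf0 hf1 hf using fun n => exists_positive_functional_norm_posPart (z n)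
  obtain ⟨T, hT0, hTu, hTv⟩ := exists_order_sum_operator hF hf0
    (fun n => dual_apply_le_norm (hf1 n)) hv0 hvu
  refine ⟨T, hT0, weakAlmostLimited_of_abs_le hF hu fun x => ?_, fun hDP => ?_⟩
  · have h1 := hTu |x| (abs_nonneg x)
    rw [norm_abs_eq_norm] at h1
    refine le_trans (abs_le'.2 ⟨?_, ?_⟩) h1
    · have := hT0 (|x| - x) (sub_nonneg.2 (le_abs_self x))
      rwa [map_sub, sub_nonneg] at this
    · have := hT0 (|x| - -x) (sub_nonneg.2 (neg_le_abs x))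
      rwa [map_sub, map_neg, sub_nonneg] at this
  · have hlim := hDP z (fun i j hij => by
      simpa only [abs_of_nonneg (hz0 _)] using hzd hij) hz
    obtain ⟨n, hn⟩ := (hlim.eventually (gt_mem_nhds (mul_pos hε hδ))).exists
    refine absurd hn (not_lt.2 ?_)
    have h1 := norm_le_norm_of_nonneg_of_le
      (smul_nonneg (dual_apply_nonneg (hf0 n) (hz0 n)) (hv0 n)) (hTv n (z n) (hz0 n))
    rw [norm_smul, hf n, posPart_of_nonneg (hz0 n), norm_norm] at h1
    exact (mul_le_mul (hzε n) (hvδ n) hδ.le (norm_nonneg _)).trans h1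

end Operators

end BanachLat

theorem mainTheorem2
    {E : Type*} [NormedAddCommGroup E] [NormedSpace ℝ E] [CompleteSpace E] [Lattice E]
    [IsOrderedAddMonoid E] [IsOrderedModule ℝ E] [HasSolidNorm E]
    {F : Type*} [NormedAddCommGroup F] [NormedSpace ℝ F] [CompleteSpace F] [Lattice F]
    [IsOrderedAddMonoid F] [IsOrderedModule ℝ F] [HasSolidNorm F]
    (hF : BanachLat.SigmaDedekindComplete F) :
    List.TFAE
      [∀ T : E →L[ℝ] F, BanachLat.OrderBoundedOp T → BanachLat.WeakAlmostLimited T →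
          BanachLat.AlmostDunfordPettis T,
        ∀ T : E →L[ℝ] F, BanachLat.PositiveOp T → BanachLat.WeakAlmostLimited T →
          BanachLat.AlmostDunfordPettis T,
        BanachLat.PositiveSchur E ∨ BanachLat.OrderContinuousNorm F] := by
  tfae_have 1 → 2 := fun h T hT => h T hT.orderBoundedOp
  tfae_have 2 → 3 := fun h => by
    by_contra! hcon
    obtain ⟨T, hT, hTw, hTD⟩ :=
      BanachLat.exists_positive_weakAlmostLimited_not_almostDunfordPettis hF hcon.1 hcon.2
    exact hTD (h T hT hTw)
  tfae_have 3 → 1 := by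
    rintro (h | h) T hT hTw
    · exact h.almostDunfordPettis T
    · exact h.almostDunfordPettis hF hT hTw
  tfae_finish
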